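/- All algebras are finite-dimensional. A (left) Leibniz algebra over a field $K$ is a $K$-vector space $A$ with a bilinear product satisfying $x(yz)=(xy)z+y(xz)$. Write $UW$ for the span of the products $uw$ ($u\in U$, $w\in W$), and $A^2=AA$. Ideals are two-sided. $A$ is abelian if $A^2=0$, metabelian if $A^2$ is abelian, nilpotent if $A^n=0$ for some $n$, where $A^1=A$ and $A^{n+1}=A\,A^n$, and solvable if its derived series $A^{(0)}=A$, $A^{(n+1)}=A^{(n)}A^{(n)}$ reaches $0$. The Frattini subalgebra $F(A)$ is the intersection of all maximal subalgebras of $A$ ($F(A)=A$ if there are none), and the Frattini ideal $\Phi(A)$ is the largest ideal of $A$ contained in $F(A)$. $A$ is elementary if $\Phi(M)=0$ for every subalgebra $M$ of $A$. $\mathrm{Asoc}(A)$ is the sum of all abelian minimal ideals of $A$. Let $V$ be a vector space, let $B\subseteq \mathfrak{gl}(V)$ be an abelian Lie subalgebra acting completely reducibly on $V$, and let $V=V_1\oplus V_2$ with $V_1,V_2$ $B$-invariant. On the vector space $V_1\oplus V_2\oplus B$ consider the product $$(v_1+v_2+b)(w_1+w_2+c)=\bigl(b(w_1)-c(v_1)\bigr)+b(w_2)\qquad(v_i,w_i\in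 V_i,\ b,c\in B),$$ that is, the product of the semidirect sum of $V$ and $B$, except that $V_2B=0$. An algebra isomorphic to one obtained in this way is said to be of type I. Theorem. Let $A$ be a finite-dimensional solvable Leibniz algebra over a perfect field $K$. The following are equivalent: 1. $A$ is elementary; 2. $\Phi(A)=0$ and $A^2$ is nilpotent; 3. $\Phi(A)=0$ and $A$ is metabelian; 4. $\mathrm{Asoc}(A)$ is complemented by an abelian subalgebra: there is an abelian subalgebra $C$ of $A$ with $A=\mathrm{Asoc}(A)+C$ and $\mathrm{Asoc}(A)\cap C=0$; 5. $A=B\oplus E$ is the direct sum of two ideals $B$ and $E$, where $B$ is abelian and $E$ is of type I. -/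

import Mathlib

/-! Nonassociative algebras over a field `K` are Mathlib's nonunital nonassociative algebras;
subalgebras are `NonUnitalSubalgebra K A`. -/

namespace LeibnizAlg

universe u v

/-- The (left) Leibniz identity: left multiplications are derivations. -/
def IsLeibniz (A : Type v) [NonUnitalNonAssocRing A] : Prop :=
  ∀ x y z : A, x * (y * z) = (x * y) * z + y * (x * z)

section Basic

variable {K : Type u} {A : Type v} [Field K] [NonUnitalNonAssocRing A] [Module K A]
  [IsScalarTower K A A] [SMulCommClass K A A]

/-- The product `U W` of two subspaces: the span of all `u * w` with `u ∈ U`, `w ∈ W`. -/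
def prod (U W : Submodule K A) : Submodule K A :=
  Submodule.span K {a : A | ∃ u ∈ U, ∃ w ∈ W, a = u * w}

/-- A subspace is a (two-sided) ideal. -/
def IsIdeal (I : Submodule K A) : Prop :=
  ∀ a : A, ∀ x ∈ I, a * x ∈ I ∧ x * a ∈ I

/-- All products of two elements of the subspace vanish. -/
def IsAbelian (U : Submodule K A) : Prop :=
  ∀ x ∈ U, ∀ y ∈ U, x * y = 0

/-- `I` is a minimal ideal: a nonzero ideal that contains no ideals other than `0` and `I`. -/
def IsMinimalIdeal (I : Submodule K A) : Prop :=
  IsIdeal I ∧ I ≠ ⊥ ∧ ∀ J : Submodule K A, IsIdeal J → J ≤ I → J = ⊥ ∨ J = I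

/-- `lowerPower U n` is `U ^ (n + 1)`, where `U ^ 1 = U` and `U ^ (n + 1) = U (U ^ n)`. -/
def lowerPower (U : Submodule K A) : ℕ → Submodule K A
  | 0 => U
  | n + 1 => prod U (lowerPower U n)

/-- Nilpotency, as an algebra, of a subalgebra with underlying subspace `U`. -/
def IsNilpotentSub (U : Submodule K A) : Prop :=
  ∃ n : ℕ, lowerPower U n = ⊥

variable (K A)

/-- The square `A ^ 2 = A A`. -/
def square : Submodule K A := prod ⊤ ⊤

/-- The derived series of `A`. -/
def derivedSeries : ℕ → Submodule K A
  | 0 => ⊤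
  | n + 1 => prod (derivedSeries n) (derivedSeries n)

/-- `A` is solvable. -/
def IsSolvableAlg : Prop := ∃ n : ℕ, derivedSeries K A n = ⊥

/-- `A` is metabelian: `A ^ 2` is abelian. -/
def IsMetabelian : Prop := IsAbelian (square K A)

/-- The Frattini subalgebra `F(A)`: the intersection of all maximal subalgebras (it is `A` if there
are none). -/
def frattiniSubalgebra : NonUnitalSubalgebra K A :=
  sInf {M : NonUnitalSubalgebra K A | IsCoatom M}

/-- The Frattini ideal `Φ(A)`: the largest ideal of `A` contained in `F(A)`, that is, the sum of all
such ideals. -/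
def frattiniIdeal : Submodule K A :=
  sSup {I : Submodule K A | IsIdeal I ∧ I ≤ (frattiniSubalgebra K A).toSubmodule}

/-- The abelian socle: the sum of all abelian minimal ideals. -/
def asoc : Submodule K A :=
  sSup {I : Submodule K A | IsMinimalIdeal I ∧ IsAbelian I}

/-- `A` is elementary: the Frattini ideal of every subalgebra of `A` is zero. -/
def IsElementary : Prop :=
  ∀ M : NonUnitalSubalgebra K A, frattiniIdeal K M = ⊥

end Basic

section TypeOne

attribute [local instance] LieRing.ofAssociativeRing

variable {K : Type u} {V : Type v} [Field K] [AddCommGroup V] [Module K V]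
  {B : LieSubalgebra K (Module.End K V)}

/-- For a Lie subalgebra `B` of `gl(V)` and `B`-submodules `V₁`, `V₂`, the vector space
`V₁ ⊕ V₂ ⊕ B`. When `V = V₁ ⊕ V₂`, this is the vector space `V ⊕ B`. -/
def SemidirectStar (V₁ V₂ : LieSubmodule K B V) : Type v := V₁ × V₂ × B

variable (V₁ V₂ : LieSubmodule K B V)

instance : AddCommGroup (SemidirectStar V₁ V₂) := inferInstanceAs (AddCommGroup (V₁ × V₂ × B))

instance : Module K (SemidirectStar V₁ V₂) := inferInstanceAs (Module K (V₁ × V₂ × B))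

/-- The multiplication of the semidirect sum of `V₁ ⊕ V₂` and `B`, in which
`(v + b) (w + c) = b w - c v + [b, c]`, except that the products in `V₂ B` are replaced by zero. -/
instance : Mul (SemidirectStar V₁ V₂) where
  mul x y := ((⁅x.2.2, y.1⁆ - ⁅y.2.2, x.1⁆, ⁅x.2.2, y.2.1⁆, ⁅x.2.2, y.2.2⁆) : V₁ × V₂ × B)

theorem SemidirectStar.mul_def (x y : SemidirectStar V₁ V₂) :
    x * y = ((⁅x.2.2, y.1⁆ - ⁅y.2.2, x.1⁆, ⁅x.2.2, y.2.1⁆, ⁅x.2.2, y.2.2⁆) : V₁ × V₂ × B) := rfl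

instance : NonUnitalNonAssocRing (SemidirectStar V₁ V₂) where
  __ := (inferInstance : AddCommGroup (SemidirectStar V₁ V₂))
  __ := (inferInstance : Mul (SemidirectStar V₁ V₂))
  left_distrib x y z := by
    obtain ⟨x₁, x₂, x₃⟩ := x
    obtain ⟨y₁, y₂, y₃⟩ := y
    obtain ⟨z₁, z₂, z₃⟩ := z
    refine Prod.ext ?_ (Prod.ext ?_ ?_)
    · change ⁅x₃, y₁ + z₁⁆ - ⁅y₃ + z₃, x₁⁆ = (⁅x₃, y₁⁆ - ⁅y₃, x₁⁆) + (⁅x₃, z₁⁆ - ⁅z₃, x₁⁆)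
      rw [lie_add, add_lie]; abel
    · exact lie_add x₃ y₂ z₂
    · exact lie_add x₃ y₃ z₃
  right_distrib x y z := by
    obtain ⟨x₁, x₂, x₃⟩ := x
    obtain ⟨y₁, y₂, y₃⟩ := y
    obtain ⟨z₁, z₂, z₃⟩ := z
    refine Prod.ext ?_ (Prod.ext ?_ ?_)
    · change ⁅x₃ + y₃, z₁⁆ - ⁅z₃, x₁ + y₁⁆ = (⁅x₃, z₁⁆ - ⁅z₃, x₁⁆) + (⁅y₃, z₁⁆ - ⁅z₃, y₁⁆)
      rw [lie_add, add_lie]; abel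
    · exact add_lie x₃ y₃ z₂
    · exact add_lie x₃ y₃ z₃
  zero_mul x := by
    obtain ⟨x₁, x₂, x₃⟩ := x
    refine Prod.ext ?_ (Prod.ext ?_ ?_)
    · change ⁅(0 : B), x₁⁆ - ⁅x₃, (0 : V₁)⁆ = 0
      rw [zero_lie, lie_zero, sub_zero]
    · exact zero_lie x₂
    · exact zero_lie x₃
  mul_zero x := by
    obtain ⟨x₁, x₂, x₃⟩ := x
    refine Prod.ext ?_ (Prod.ext ?_ ?_)
    · change ⁅x₃, (0 : V₁)⁆ - ⁅(0 : B), x₁⁆ = 0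
      rw [zero_lie, lie_zero, sub_zero]
    · exact lie_zero x₃
    · exact lie_zero x₃

/-- `E` is of type I: for some vector space `V`, some abelian Lie subalgebra `B` of `gl(V)` that acts
completely reducibly on `V`, and some decomposition `V = V₁ ⊕ V₂` into `B`-submodules (equivalently,
into ideals of the semidirect sum of `V` and `B`), `E` is isomorphic to that semidirect sum with the
products in `V₂ B` replaced by zero. -/
def IsTypeOne (K : Type u) (E : Type v) [Field K] [NonUnitalNonAssocRing E] [Module K E] : Prop :=
  ∃ (V : Type v) (_ : AddCommGroup V) (_ : Module K V) (B : LieSubalgebra K (Module.End K V))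
    (V₁ V₂ : LieSubmodule K B V),
    IsLieAbelian B ∧ ComplementedLattice (LieSubmodule K B V) ∧ IsCompl V₁ V₂ ∧
      ∃ f : SemidirectStar V₁ V₂ →ₙₐ[K] E, Function.Bijective f

end TypeOne

end LeibnizAlg

/-!
Let `S` be the abelian socle of `A`. The conditions are all compared with the fourth one, that `S`
has an abelian complement `C`.

*Consequences of `Φ(A) = 0`.* An abelian ideal has a complementary subalgebra, namely a minimal
supplement (`FrattiniTrivial.exists_complement`). Hence every abelian ideal lies in `S`
(`FrattiniTrivial.le_asoc`), and nilpotent ideals are abelian because their squares consist of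
nongenerators (`FrattiniTrivial.isAbelian_of_isNilpotent`). If `A ^ 2` is nilpotent it is therefore
abelian, so it lies in `S`, and any complement of `S` is abelian.

*From the splitting to elementarity.* The left and right multiplications on `S` commute with each
other, since on a minimal ideal the right action is either zero or the negative of the left action.
They generate a reduced algebra, because a nilpotent operator that commutes with the action vanishes
on each minimal ideal. So do the multiplications by the elements of a subalgebra `M`, and a reduced
commutative Artinian ring is semisimple; hence `M ∩ S` is a completely reducible ideal of `M`. It has
an abelian complement in `M`, and the maximal subalgebras of `M` meet in zero
(`frattiniTrivial_of_isCompl`).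

*From elementarity to the splitting.* Let `C` be a complement of `S`. Squares lie in `S`, so `C` is
anticommutative. For `x` in `C` the Frattini ideal of the subalgebra `S + K x` vanishes, which makes
the action of `x` on `S` semisimple (`isSemisimple_leftAct`). Over a perfect field `ad x` is then
semisimple on `End S`. If `x` acts nilpotently on `C`, it follows that `x C` acts trivially on `S`,
and `C` acts faithfully on `S` (`eq_zero_of_mul_asoc_eq_zero`). Downward induction along
the derived series shows that `C` is abelian.

*Type I.* In a split algebra, `V₂` is the part of `S` that annihilates `A` from the left and `V₁` a
complementary ideal, so that `A` itself is of type I (`isTypeOne_of_isCompl`). Conversely, in the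
direct sum of an abelian ideal and an algebra on `V₁ ⊕ V₂ ⊕ L`, the ideal, `V₁` and `V₂` together
form the abelian socle (`exists_abelian_isCompl_of_isTypeOne`).
-/

namespace LeibnizAlg

set_option linter.unusedSectionVars false

/-! ### Invariant subspaces of commuting families of operators -/

section Operators

variable {K V : Type*} [Field K] [AddCommGroup V] [Module K V]

/-- A subspace stable under a family `G` of operators, as a module over the algebra generated
by `G`. -/
def invariantSubmodule (G : Set (Module.End K V)) (W : Submodule K V)
    (hW : ∀ g ∈ G, ∀ w ∈ W, g w ∈ W) : Submodule (Algebra.adjoin K G) V where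
  carrier := W
  add_mem' := W.add_mem
  zero_mem' := W.zero_mem
  smul_mem' := by
    rintro ⟨q, hq⟩
    change ∀ w ∈ W, q w ∈ W
    induction hq using Algebra.adjoin_induction with
    | mem g hg => exact hW g hg
    | algebraMap r => exact fun w hw ↦ W.smul_mem r hw
    | add p q _ _ hp hq => exact fun w hw ↦ W.add_mem (hp w hw) (hq w hw)
    | mul p q _ _ hp hq => exact fun w hw ↦ hp _ (hq w hw)

variable [FiniteDimensional K V]

/-- A commutative algebra of operators without nonzero nilpotents is a reduced Artinian ring, so
all of its modules are semisimple. -/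
theorem isSemisimpleModule_adjoin {G : Set (Module.End K V)}
    (hcomm : ∀ f ∈ G, ∀ g ∈ G, f * g = g * f)
    (hred : ∀ q ∈ Algebra.adjoin K G, IsNilpotent q → q = 0) :
    IsSemisimpleModule (Algebra.adjoin K G) V := by
  have hmul := Algebra.isMulCommutative_adjoin K hcomm
  let _ : CommRing (Algebra.adjoin K G) :=
    { (inferInstance : Ring (Algebra.adjoin K G)) with mul_comm := hmul.is_comm.comm }
  have : IsReduced (Algebra.adjoin K G) := by
    refine ⟨fun q hq ↦ ?_⟩
    exact Subtype.ext (hred q q.2 (hq.map (Algebra.adjoin K G).val))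
  have : IsArtinianRing (Algebra.adjoin K G) := IsArtinianRing.of_finite K _
  have : IsSemisimpleRing (Algebra.adjoin K G) := IsArtinianRing.isSemisimpleRing_of_isReduced _
  infer_instance

theorem exists_invariant_isCompl {G : Set (Module.End K V)}
    (hcomm : ∀ f ∈ G, ∀ g ∈ G, f * g = g * f)
    (hred : ∀ q ∈ Algebra.adjoin K G, IsNilpotent q → q = 0)
    (W : Submodule K V) (hW : ∀ g ∈ G, ∀ w ∈ W, g w ∈ W) :
    ∃ W' : Submodule K V, (∀ g ∈ G, ∀ w ∈ W', g w ∈ W') ∧ IsCompl W W' := by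
  have := isSemisimpleModule_adjoin hcomm hred
  obtain ⟨X, hX⟩ := exists_isCompl (invariantSubmodule G W hW)
  refine ⟨X.restrictScalars K, fun g hg w hw ↦ ?_, ?_, ?_⟩
  · exact X.smul_mem ⟨g, Algebra.subset_adjoin hg⟩ hw
  · rw [Submodule.disjoint_def]
    intro v hv hv'
    exact Submodule.disjoint_def.mp hX.disjoint v hv hv'
  · rw [codisjoint_iff, eq_top_iff]
    rintro v -
    have : v ∈ invariantSubmodule G W hW ⊔ X := by rw [hX.sup_eq_top]; trivial
    obtain ⟨a, ha, b, hb, rfl⟩ := Submodule.mem_sup.mp this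
    exact Submodule.add_mem_sup ha hb

/-- In a semisimple module the maximal submodules meet in zero. -/
theorem exists_maximal_invariant {G : Set (Module.End K V)}
    (hcomm : ∀ f ∈ G, ∀ g ∈ G, f * g = g * f)
    (hred : ∀ q ∈ Algebra.adjoin K G, IsNilpotent q → q = 0) {v : V} (hv : v ≠ 0) :
    ∃ X : Submodule K V, (∀ g ∈ G, ∀ w ∈ X, g w ∈ X) ∧ v ∉ X ∧
      ∀ Y : Submodule K V, (∀ g ∈ G, ∀ w ∈ Y, g w ∈ Y) → Y ≤ X ∨ X ⊔ Y = ⊤ := by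
  have := isSemisimpleModule_adjoin hcomm hred
  have hj : v ∉ Module.jacobson (Algebra.adjoin K G) V := by
    rw [IsSemisimpleModule.jacobson_eq_bot]
    simpa using hv
  simp only [Module.jacobson, Submodule.mem_sInf, not_forall] at hj
  obtain ⟨X, hX, hvX⟩ := hj
  refine ⟨X.restrictScalars K, fun g hg w hw ↦ ?_, hvX, fun Y hY ↦ ?_⟩
  · exact X.smul_mem ⟨g, Algebra.subset_adjoin hg⟩ hw
  · by_cases hle : Y ≤ X.restrictScalars K
    · exact Or.inl hle
    · right
      have hlt : X < X ⊔ invariantSubmodule G Y hY := by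
        rw [left_lt_sup]
        exact fun h ↦ hle fun y hy ↦ h hy
      have htop := (show IsCoatom X from hX).2 _ hlt
      rw [eq_top_iff]
      rintro u -
      have : u ∈ X ⊔ invariantSubmodule G Y hY := by rw [htop]; trivial
      obtain ⟨a, ha, b, hb, rfl⟩ := Submodule.mem_sup.mp this
      exact Submodule.add_mem_sup ha hb

end Operators

/-! ### Products, ideals and minimal ideals -/

section Ideals

variable {K A : Type*} [Field K] [NonUnitalNonAssocRing A] [Module K A]
  [IsScalarTower K A A] [SMulCommClass K A A]

theorem mul_mem_prod {U W : Submodule K A} {u w : A} (hu : u ∈ U) (hw : w ∈ W) :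
    u * w ∈ prod U W :=
  Submodule.subset_span ⟨u, hu, w, hw, rfl⟩

theorem prod_le {U W X : Submodule K A} : prod U W ≤ X ↔ ∀ u ∈ U, ∀ w ∈ W, u * w ∈ X := by
  refine Submodule.span_le.trans ⟨fun h u hu w hw ↦ h ⟨u, hu, w, hw, rfl⟩, ?_⟩
  rintro h _ ⟨u, hu, w, hw, rfl⟩
  exact h u hu w hw

theorem mul_mem_square (a b : A) : a * b ∈ square K A :=
  mul_mem_prod trivial trivial

theorem prod_eq_bot_iff {U : Submodule K A} : prod U U = ⊥ ↔ IsAbelian U := by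
  rw [eq_bot_iff, prod_le]
  rfl

theorem IsLeibniz.mul_mul (hA : IsLeibniz A) (x y z : A) :
    (x * y) * z = x * (y * z) - y * (x * z) := by
  rw [hA x y z]; abel

theorem isIdeal_top : IsIdeal (⊤ : Submodule K A) := fun _ _ _ ↦ ⟨trivial, trivial⟩

theorem IsIdeal.inf {I J : Submodule K A} (hI : IsIdeal I) (hJ : IsIdeal J) : IsIdeal (I ⊓ J) :=
  fun a x hx ↦ ⟨⟨(hI a x hx.1).1, (hJ a x hx.2).1⟩, ⟨(hI a x hx.1).2, (hJ a x hx.2).2⟩⟩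

theorem isIdeal_sSup {s : Set (Submodule K A)} (hs : ∀ I ∈ s, IsIdeal I) : IsIdeal (sSup s) := by
  intro a x hx
  have hl : sSup s ≤ (sSup s).comap (LinearMap.mulLeft K a) :=
    sSup_le fun I hI y hy ↦ le_sSup hI (hs I hI a y hy).1
  have hr : sSup s ≤ (sSup s).comap (LinearMap.mulRight K a) :=
    sSup_le fun I hI y hy ↦ le_sSup hI (hs I hI a y hy).2
  exact ⟨hl hx, hr hx⟩

theorem IsIdeal.prod_self (hA : IsLeibniz A) {I : Submodule K A} (hI : IsIdeal I) :
    IsIdeal (prod I I) := by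
  intro a x hx
  constructor
  · have : prod I I ≤ (prod I I).comap (LinearMap.mulLeft K a) := prod_le.mpr fun u hu w hw ↦ by
      change a * (u * w) ∈ prod I I
      rw [hA a u w]
      exact add_mem (mul_mem_prod (hI a u hu).1 hw) (mul_mem_prod hu (hI a w hw).1)
    exact this hx
  · have : prod I I ≤ (prod I I).comap (LinearMap.mulRight K a) := prod_le.mpr fun u hu w hw ↦ by
      change (u * w) * a ∈ prod I I
      rw [hA.mul_mul u w a]
      exact sub_mem (mul_mem_prod hu (hI a w hw).2) (mul_mem_prod hw (hI a u hu).2)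
    exact this hx

theorem isIdeal_derivedSeries (hA : IsLeibniz A) : ∀ n, IsIdeal (derivedSeries K A n)
  | 0 => isIdeal_top
  | n + 1 => (isIdeal_derivedSeries hA n).prod_self hA

/-- `I ^ i I ^ j ⊆ I ^ (i + j)`, with the powers shifted by one as in `lowerPower`. -/
theorem mul_mem_lowerPower (hA : IsLeibniz A) (I : Submodule K A) (i : ℕ) :
    ∀ j, ∀ x ∈ lowerPower I i, ∀ y ∈ lowerPower I j, x * y ∈ lowerPower I (i + j + 1) := by
  induction i with
  | zero =>
    intro j x hx y hy
    rw [zero_add]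
    exact mul_mem_prod hx hy
  | succ i ih =>
    intro j x hx y hy
    have : lowerPower I (i + 1) ≤
        (lowerPower I (i + 1 + j + 1)).comap (LinearMap.mulRight K y) :=
      prod_le.mpr fun u hu w hw ↦ by
        change (u * w) * y ∈ lowerPower I (i + 1 + j + 1)
        rw [hA.mul_mul]
        refine sub_mem ?_ ?_
        · rw [show i + 1 + j + 1 = (i + j + 1) + 1 by omega]
          exact mul_mem_prod hu (ih j w hw y hy)
        · rw [show i + 1 + j + 1 = i + (j + 1) + 1 by omega]
          exact ih (j + 1) w hw _ (mul_mem_prod hu hy)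
    exact this hx

theorem lowerPower_le {I : Submodule K A} (hI : IsIdeal I) : ∀ n, lowerPower I n ≤ I
  | 0 => le_rfl
  | n + 1 => prod_le.mpr fun u _ w hw ↦ (hI u w (lowerPower_le hI n hw)).1

theorem exists_isMinimalIdeal_le [FiniteDimensional K A] {J : Submodule K A} (hJ : IsIdeal J)
    (hne : J ≠ ⊥) : ∃ N : Submodule K A, IsMinimalIdeal N ∧ N ≤ J := by
  obtain ⟨N, ⟨hN, hN0, hNJ⟩, hmin⟩ := (wellFounded_lt (α := Submodule K A)).has_min
    {I | IsIdeal I ∧ I ≠ ⊥ ∧ I ≤ J} ⟨J, hJ, hne, le_rfl⟩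
  refine ⟨N, ⟨hN, hN0, fun X hX hXN ↦ or_iff_not_imp_left.mpr fun hX0 ↦ ?_⟩, hNJ⟩
  by_contra hXne
  exact hmin X ⟨hX, hX0, hXN.trans hNJ⟩ (lt_of_le_of_ne hXN hXne)

theorem IsAbelian.mono {I J : Submodule K A} (hJ : IsAbelian J) (h : I ≤ J) : IsAbelian I :=
  fun x hx y hy ↦ hJ x (h hx) y (h hy)

theorem isIdeal_asoc : IsIdeal (asoc K A) := isIdeal_sSup fun _ h ↦ h.1.1

theorem le_asoc {N : Submodule K A} (hN : IsMinimalIdeal N) (hab : IsAbelian N) :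
    N ≤ asoc K A := le_sSup ⟨hN, hab⟩

/-- A property of vectors that defines a subspace holds on the abelian socle as soon as it holds on
the abelian minimal ideals. -/
theorem asoc_le {X : Submodule K A}
    (h : ∀ N : Submodule K A, IsMinimalIdeal N → IsAbelian N → N ≤ X) : asoc K A ≤ X :=
  sSup_le fun N hN ↦ h N hN.1 hN.2

/-- Distinct minimal ideals annihilate each other, because they intersect trivially. -/
theorem isAbelian_asoc : IsAbelian (asoc K A) := by
  intro x hx y hy
  have key : asoc K A ≤ LinearMap.ker (LinearMap.mulRight K y) := asoc_le fun M hM hMab m hm ↦ by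
    have : asoc K A ≤ LinearMap.ker (LinearMap.mulLeft K m) := asoc_le fun N hN hNab n hn ↦ by
      change m * n = 0
      by_cases hMN : M = N
      · subst hMN; exact hMab m hm n hn
      · have hmem : m * n ∈ M ⊓ N := ⟨(hM.1 n m hm).2, (hN.1 m n hn).1⟩
        rcases hM.2.2 (M ⊓ N) (hM.1.inf hN.1) inf_le_left with h | h
        · rwa [h, Submodule.mem_bot] at hmem
        · rcases hN.2.2 M hM.1 (inf_eq_left.mp h) with h' | h'
          · exact absurd h' hM.2.1
          · exact absurd h' hMN
    exact this hy
  exact key hx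

/-- An abelian ideal whose lattice of ideals is complemented is a sum of minimal ideals. -/
theorem le_asoc_of_forall_exists_isCompl [FiniteDimensional K A] {I : Submodule K A}
    (hI : IsIdeal I) (hab : IsAbelian I)
    (h : ∀ J : Submodule K A, IsIdeal J → J ≤ I →
      ∃ J' : Submodule K A, IsIdeal J' ∧ J ⊓ J' = ⊥ ∧ J ⊔ J' = I) : I ≤ asoc K A := by
  obtain ⟨J', hJ', hinf, hsup⟩ := h (I ⊓ asoc K A) (hI.inf isIdeal_asoc) inf_le_left
  have hJ'I : J' ≤ I := hsup ▸ le_sup_right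
  have : J' = ⊥ := by
    by_contra hne
    obtain ⟨N, hN, hNJ⟩ := exists_isMinimalIdeal_le hJ' hne
    apply hN.2.1
    rw [eq_bot_iff, ← hinf]
    exact le_inf (le_inf (hNJ.trans hJ'I) (le_asoc hN (hab.mono (hNJ.trans hJ'I)))) hNJ
  rw [this, sup_bot_eq] at hsup
  exact inf_eq_left.mp hsup

end Ideals

/-! ### The Frattini ideal -/

section Frattini

variable {K A : Type*} [Field K] [NonUnitalNonAssocRing A] [Module K A]
  [IsScalarTower K A A] [SMulCommClass K A A]

/-- `I` is an ideal of the subalgebra `M`, regarded as a subspace of the ambient algebra. -/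
def IsIdealOf (M : NonUnitalSubalgebra K A) (I : Submodule K A) : Prop :=
  I ≤ M.toSubmodule ∧ ∀ m ∈ M, ∀ x ∈ I, m * x ∈ I ∧ x * m ∈ I

/-- The Frattini ideal of the subalgebra `M` vanishes: no nonzero ideal of `M` lies in all maximal
subalgebras of `M`. The maximal subalgebras of `M` are the subalgebras of `A` covered by `M`, so
that `M` need not be viewed as an algebra in its own right. -/
def FrattiniTrivial (M : NonUnitalSubalgebra K A) : Prop :=
  ∀ I : Submodule K A, IsIdealOf M I → (∀ U : NonUnitalSubalgebra K A, U ⋖ M → I ≤ U.toSubmodule) →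
    I = ⊥

theorem isIdealOf_top {I : Submodule K A} :
    IsIdealOf (⊤ : NonUnitalSubalgebra K A) I ↔ IsIdeal I :=
  ⟨fun h a x hx ↦ h.2 a trivial x hx, fun h ↦ ⟨fun _ _ ↦ trivial, fun m _ x hx ↦ h m x hx⟩⟩

theorem frattiniIdeal_eq_bot_iff : frattiniIdeal K A = ⊥ ↔ ∀ I : Submodule K A, IsIdeal I →
    (∀ U : NonUnitalSubalgebra K A, IsCoatom U → I ≤ U.toSubmodule) → I = ⊥ := by
  rw [frattiniIdeal, sSup_eq_bot]
  refine ⟨fun h I hI hU ↦ h I ⟨hI, fun x hx ↦ ?_⟩, fun h I hI ↦ h I hI.1 fun U hU x hx ↦ ?_⟩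
  · exact NonUnitalAlgebra.mem_sInf.mpr fun U hUc ↦ hU U hUc hx
  · exact NonUnitalAlgebra.mem_sInf.mp (hI.2 hx) U hU

theorem frattiniIdeal_eq_bot_iff_top :
    frattiniIdeal K A = ⊥ ↔ FrattiniTrivial (⊤ : NonUnitalSubalgebra K A) := by
  simp only [frattiniIdeal_eq_bot_iff, FrattiniTrivial, isIdealOf_top, covBy_top_iff]

/-- The maximal subalgebras of `M` as an algebra correspond to the subalgebras covered by `M`. -/
theorem isCoatom_iff_map_covBy (M : NonUnitalSubalgebra K A) (U : NonUnitalSubalgebra K M) :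
    IsCoatom U ↔ U.map (NonUnitalSubalgebraClass.subtype M) ⋖ M := by
  have hinj : Function.Injective (NonUnitalSubalgebraClass.subtype M) := Subtype.val_injective
  have hlt : ∀ X Y : NonUnitalSubalgebra K M, X.map (NonUnitalSubalgebraClass.subtype M) <
      Y.map (NonUnitalSubalgebraClass.subtype M) ↔ X < Y := by
    have hle : ∀ X Y : NonUnitalSubalgebra K M, X.map (NonUnitalSubalgebraClass.subtype M) ≤
        Y.map (NonUnitalSubalgebraClass.subtype M) ↔ X ≤ Y := fun X Y ↦ by
      refine ⟨fun h x hx ↦ ?_, fun h ↦ NonUnitalSubalgebra.map_mono h⟩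
      obtain ⟨y, hy, hyx⟩ := NonUnitalSubalgebra.mem_map.mp
        (h (NonUnitalSubalgebra.mem_map.mpr ⟨x, hx, rfl⟩))
      exact hinj hyx ▸ hy
    intro X Y
    rw [lt_iff_le_not_ge, lt_iff_le_not_ge, hle, hle]
  have htop : (⊤ : NonUnitalSubalgebra K M).map (NonUnitalSubalgebraClass.subtype M) = M := by
    ext x
    refine ⟨?_, fun hx ↦ NonUnitalSubalgebra.mem_map.mpr ⟨⟨x, hx⟩, trivial, rfl⟩⟩
    intro hx
    obtain ⟨y, -, rfl⟩ := NonUnitalSubalgebra.mem_map.mp hx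
    exact y.2
  have hcomap : ∀ Y : NonUnitalSubalgebra K A, Y ≤ M →
      (Y.comap (NonUnitalSubalgebraClass.subtype M)).map (NonUnitalSubalgebraClass.subtype M)
        = Y := by
    intro Y hY
    ext x
    refine ⟨?_, fun hx ↦ NonUnitalSubalgebra.mem_map.mpr ⟨⟨x, hY hx⟩, hx, rfl⟩⟩
    intro hx
    obtain ⟨y, hy, rfl⟩ := NonUnitalSubalgebra.mem_map.mp hx
    exact hy
  rw [← covBy_top_iff]
  constructor
  · intro h
    refine ⟨by conv_rhs => rw [← htop]
               exact (hlt _ _).mpr h.1, fun Y hUY hYM ↦ ?_⟩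
    rw [← hcomap Y hYM.le] at hUY hYM
    refine h.2 ((hlt _ _).mp hUY) ((hlt _ _).mp ?_)
    rwa [htop]
  · intro h
    refine ⟨(hlt _ _).mp (by rw [htop]; exact h.1), fun Y hUY hYM ↦ ?_⟩
    refine h.2 ((hlt _ _).mpr hUY) ?_
    rw [← hlt, htop] at hYM
    exact hYM

theorem frattiniIdeal_coe_eq_bot_iff (M : NonUnitalSubalgebra K A) :
    frattiniIdeal K M = ⊥ ↔ FrattiniTrivial M := by
  rw [frattiniIdeal_eq_bot_iff]
  constructor
  · intro h I hI hU
    have := h (I.comap M.toSubmodule.subtype)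
      (fun a x hx ↦ hI.2 a a.2 x hx)
      (fun U hUc x hx ↦ by
        have := hU _ ((isCoatom_iff_map_covBy M U).mp hUc) hx
        obtain ⟨y, hy, hyx⟩ := NonUnitalSubalgebra.mem_map.mp this
        exact (Subtype.ext hyx : y = x) ▸ hy)
    rw [eq_bot_iff]
    intro x hx
    have hx' : (⟨x, hI.1 hx⟩ : M.toSubmodule) ∈ I.comap M.toSubmodule.subtype := hx
    have hx0 := (Submodule.mem_bot K).mp (this ▸ hx')
    exact (Submodule.mem_bot K).mpr (congrArg Subtype.val hx0)
  · intro h I hI hU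
    have := h (I.map M.toSubmodule.subtype) ⟨?_, ?_⟩ ?_
    · rw [eq_bot_iff]
      intro x hx
      have hx0 : (x : A) ∈ (⊥ : Submodule K A) := this ▸ ⟨x, hx, rfl⟩
      exact (Submodule.mem_bot K).mpr (Subtype.ext ((Submodule.mem_bot K).mp hx0))
    · rintro _ ⟨x, -, rfl⟩
      exact x.2
    · rintro m hm _ ⟨x, hx, rfl⟩
      exact ⟨⟨_, (hI ⟨m, hm⟩ x hx).1, rfl⟩, ⟨_, (hI ⟨m, hm⟩ x hx).2, rfl⟩⟩
    · rintro U hUM _ ⟨x, hx, rfl⟩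
      have hmap : (U.comap (NonUnitalSubalgebraClass.subtype M)).map
          (NonUnitalSubalgebraClass.subtype M) = U := by
        ext y
        refine ⟨?_, fun hy ↦ NonUnitalSubalgebra.mem_map.mpr ⟨⟨y, hUM.le hy⟩, hy, rfl⟩⟩
        intro hy
        obtain ⟨z, hz, rfl⟩ := NonUnitalSubalgebra.mem_map.mp hy
        exact hz
      exact hU (U.comap (NonUnitalSubalgebraClass.subtype M))
        ((isCoatom_iff_map_covBy M _).mpr (by rwa [hmap])) hx

theorem isElementary_iff :
    IsElementary K A ↔ ∀ M : NonUnitalSubalgebra K A, FrattiniTrivial M :=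
  forall_congr' frattiniIdeal_coe_eq_bot_iff

/-- The sum of a subalgebra `U` and a multiplicatively closed subspace `I` that `U` normalizes. -/
def supSubalgebra (I : Submodule K A) (U : NonUnitalSubalgebra K A)
    (hU : ∀ u ∈ U, ∀ x ∈ I, u * x ∈ I ∧ x * u ∈ I) (hI : ∀ x ∈ I, ∀ y ∈ I, x * y ∈ I) :
    NonUnitalSubalgebra K A :=
  (I ⊔ U.toSubmodule).toNonUnitalSubalgebra fun a b ha hb ↦ by
    obtain ⟨x, hx, u, hu, rfl⟩ := Submodule.mem_sup.mp ha
    obtain ⟨y, hy, v, hv, rfl⟩ := Submodule.mem_sup.mp hb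
    have : (x + u) * (y + v) = (x * y + x * v + u * y) + u * v := by
      rw [mul_add, add_mul, add_mul]; abel
    rw [this]
    exact Submodule.add_mem_sup
      (add_mem (add_mem (hI x hx y hy) (hU v hv x hx).2) (hU u hu y hy).1) (U.mul_mem hu hv)

/-- A maximal subalgebra that does not contain a given ideal supplements it. -/
theorem sup_eq_of_covBy {M U : NonUnitalSubalgebra K A} (hUM : U ⋖ M) {I : Submodule K A}
    (hI : IsIdealOf M I) (hIU : ¬ I ≤ U.toSubmodule) : I ⊔ U.toSubmodule = M.toSubmodule := by
  let Y := supSubalgebra I U (fun u hu ↦ hI.2 u (hUM.le hu)) (fun x hx ↦ fun y hy ↦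
    (hI.2 x (hI.1 hx) y hy).1)
  have hUY : U < Y := by
    refine lt_of_le_of_ne (le_sup_right : U.toSubmodule ≤ I ⊔ U.toSubmodule) fun h ↦ hIU ?_
    intro x hx
    have : x ∈ Y := (le_sup_left : I ≤ I ⊔ U.toSubmodule) hx
    rwa [← h] at this
  have hYM : Y ≤ M := fun x hx ↦ (sup_le hI.1 (fun y hy ↦ hUM.le hy) : _ ≤ M.toSubmodule) hx
  have hY : Y = M := by
    by_contra hne
    exact hUM.2 hUY (lt_of_le_of_ne hYM hne)
  exact congrArg NonUnitalSubalgebra.toSubmodule hY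

/-- If the Frattini ideal of `M` vanishes, abelian ideals of `M` split off: a subalgebra that is
minimal among the supplements of the ideal is a complement. -/
theorem FrattiniTrivial.exists_complement [FiniteDimensional K A] {M : NonUnitalSubalgebra K A}
    (hM : FrattiniTrivial M) {I : Submodule K A} (hI : IsIdealOf M I) (hab : IsAbelian I) :
    ∃ D : NonUnitalSubalgebra K A, D ≤ M ∧ I ⊓ D.toSubmodule = ⊥ ∧
      I ⊔ D.toSubmodule = M.toSubmodule := by
  obtain ⟨_, ⟨D, rfl, hDM, hD⟩, hmin⟩ := (wellFounded_lt (α := Submodule K A)).has_min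
    {X | ∃ D : NonUnitalSubalgebra K A, D.toSubmodule = X ∧ D ≤ M ∧
      I ⊔ D.toSubmodule = M.toSubmodule} ⟨_, M, rfl, le_rfl, sup_eq_right.mpr hI.1⟩
  refine ⟨D, hDM, ?_, hD⟩
  have hID : IsIdealOf M (I ⊓ D.toSubmodule) := by
    refine ⟨inf_le_left.trans hI.1, fun m hm x hx ↦ ?_⟩
    refine ⟨⟨(hI.2 m hm x hx.1).1, ?_⟩, ⟨(hI.2 m hm x hx.1).2, ?_⟩⟩
    all_goals
      have hm' : m ∈ I ⊔ D.toSubmodule := hD ▸ hm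
      obtain ⟨i, hi, d, hd, rfl⟩ := Submodule.mem_sup.mp hm'
    · rw [add_mul, hab i hi x hx.1, zero_add]
      exact D.mul_mem hd hx.2
    · rw [mul_add, hab x hx.1 i hi, zero_add]
      exact D.mul_mem hx.2 hd
  refine hM _ hID fun U hU ↦ ?_
  by_contra hle
  have hsup := sup_eq_of_covBy hU hID hle
  have hUD : I ⊔ (U ⊓ D).toSubmodule = M.toSubmodule := by
    refine le_antisymm (sup_le hI.1 fun x hx ↦ hU.le hx.1) fun m hm ↦ ?_
    have hm' : m ∈ I ⊔ D.toSubmodule := hD ▸ hm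
    obtain ⟨i, hi, d, hd, rfl⟩ := Submodule.mem_sup.mp hm'
    have hd' : d ∈ I ⊓ D.toSubmodule ⊔ U.toSubmodule := hsup ▸ hDM hd
    obtain ⟨j, hj, u, hu, rfl⟩ := Submodule.mem_sup.mp hd'
    rw [← add_assoc]
    exact Submodule.add_mem_sup (add_mem hi hj.1)
      ⟨hu, (D.toSubmodule.add_mem_iff_right hj.2).mp hd⟩
  refine hmin _ ⟨U ⊓ D, rfl, inf_le_right.trans hDM, hUD⟩
    (lt_of_le_of_ne (fun x hx ↦ hx.2) fun h ↦ hle ?_)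
  intro x hx
  have : x ∈ (U ⊓ D).toSubmodule := h ▸ hx.2
  exact this.1

/-- If `Φ(A) = 0`, nilpotent ideals are abelian: their squares consist of nongenerators. -/
theorem FrattiniTrivial.isAbelian_of_isNilpotent (hA : IsLeibniz A)
    (hΦ : FrattiniTrivial (⊤ : NonUnitalSubalgebra K A)) {N : Submodule K A} (hN : IsIdeal N)
    (hnil : IsNilpotentSub N) : IsAbelian N := by
  rw [← prod_eq_bot_iff]
  have hNN : IsIdealOf ⊤ (prod N N) := isIdealOf_top.mpr (hN.prod_self hA)
  have hNNle : prod N N ≤ N := lowerPower_le hN 1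
  refine hΦ _ hNN fun U hU ↦ ?_
  by_contra hle
  have hsup := sup_eq_of_covBy hU hNN hle
  -- `N = U ∩ N + N ^ k` for all `k`, by induction from `N = U ∩ N + N ^ 2`
  have key : ∀ k, N ≤ U.toSubmodule ⊓ N ⊔ lowerPower N k := by
    intro k
    induction k with
    | zero => exact le_sup_right
    | succ k ih =>
      have hprod : prod N N ≤ U.toSubmodule ⊓ N ⊔ lowerPower N (k + 1) := by
        refine prod_le.mpr fun a ha b hb ↦ ?_
        obtain ⟨u, hu, p, hp, rfl⟩ := Submodule.mem_sup.mp (ih ha)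
        obtain ⟨v, hv, q, hq, rfl⟩ := Submodule.mem_sup.mp (ih hb)
        rw [add_mul, mul_add, add_assoc]
        refine Submodule.add_mem_sup ⟨U.mul_mem hu.1 hv.1, (hN u v hv.2).1⟩ (add_mem ?_ ?_)
        · exact mul_mem_prod hu.2 hq
        · have := mul_mem_lowerPower hA N k 0 p hp _ hb
          rwa [add_zero] at this
      intro n hn
      have hn' : n ∈ prod N N ⊔ U.toSubmodule := hsup ▸ trivial
      obtain ⟨p, hp, u, hu, rfl⟩ := Submodule.mem_sup.mp hn'
      exact add_mem (hprod hp)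
        (Submodule.mem_sup_left ⟨hu, (N.add_mem_iff_right (hNNle hp)).mp hn⟩)
  obtain ⟨k, hk⟩ := hnil
  have := key k
  rw [hk, sup_bot_eq] at this
  exact hle fun x hx ↦ (this (hNNle hx)).1

/-- If `Φ(A) = 0`, every abelian ideal is a sum of minimal ideals. -/
theorem FrattiniTrivial.le_asoc [FiniteDimensional K A]
    (hΦ : FrattiniTrivial (⊤ : NonUnitalSubalgebra K A)) {I : Submodule K A} (hI : IsIdeal I)
    (hab : IsAbelian I) : I ≤ asoc K A := by
  refine le_asoc_of_forall_exists_isCompl hI hab fun J hJ hJI ↦ ?_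
  obtain ⟨D, -, hinf, hsup⟩ :=
    hΦ.exists_complement (isIdealOf_top.mpr hJ) (hab.mono hJI)
  refine ⟨I ⊓ D.toSubmodule, fun a x hx ↦ ?_, ?_, ?_⟩
  · have ha : a ∈ J ⊔ D.toSubmodule := hsup ▸ trivial
    obtain ⟨j, hj, d, hd, rfl⟩ := Submodule.mem_sup.mp ha
    refine ⟨⟨(hI _ x hx.1).1, ?_⟩, ⟨(hI _ x hx.1).2, ?_⟩⟩
    · rw [add_mul, hab j (hJI hj) x hx.1, zero_add]
      exact D.mul_mem hd hx.2
    · rw [mul_add, hab x hx.1 j (hJI hj), zero_add]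
      exact D.mul_mem hx.2 hd
  · rw [eq_bot_iff, ← hinf]
    exact inf_le_inf_left _ inf_le_right
  · rw [inf_comm, ← sup_inf_assoc_of_le _ hJI, hsup]
    exact top_inf_eq _

theorem exists_asoc_isCompl [FiniteDimensional K A]
    (hΦ : FrattiniTrivial (⊤ : NonUnitalSubalgebra K A)) :
    ∃ C : NonUnitalSubalgebra K A, IsCompl (asoc K A) C.toSubmodule := by
  obtain ⟨C, -, hinf, hsup⟩ :=
    hΦ.exists_complement (isIdealOf_top.mpr isIdeal_asoc) isAbelian_asoc
  exact ⟨C, disjoint_iff.mpr hinf, codisjoint_iff.mpr hsup⟩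

/-- A metabelian algebra with `Φ(A) = 0` splits over its abelian socle, which contains `A ^ 2`. -/
theorem exists_abelian_isCompl_of_isMetabelian [FiniteDimensional K A] (hA : IsLeibniz A)
    (hΦ : FrattiniTrivial (⊤ : NonUnitalSubalgebra K A)) (hmet : IsMetabelian K A) :
    ∃ C : NonUnitalSubalgebra K A, IsAbelian C.toSubmodule ∧
      IsCompl (asoc K A) C.toSubmodule := by
  obtain ⟨C, hC⟩ := exists_asoc_isCompl hΦ
  have hsq : square K A ≤ asoc K A := hΦ.le_asoc (isIdeal_top.prod_self hA) hmet
  exact ⟨C, fun x hx y hy ↦ Submodule.disjoint_def.mp hC.disjoint _ (hsq (mul_mem_square x y))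
    (C.mul_mem hx hy), hC⟩

end Frattini

/-! ### The action on the abelian socle -/

section Action

variable {K A : Type*} [Field K] [NonUnitalNonAssocRing A] [Module K A]
  [IsScalarTower K A A] [SMulCommClass K A A]

/-- Left multiplications, as operators on an ideal. -/
def leftAct {S : Submodule K A} (hS : IsIdeal S) : A →ₗ[K] Module.End K S where
  toFun a := (LinearMap.mulLeft K a).restrict fun x hx ↦ (hS a x hx).1
  map_add' a b := LinearMap.ext fun s ↦ Subtype.ext (add_mul a b s)
  map_smul' r a := LinearMap.ext fun s ↦ Subtype.ext (smul_mul_assoc r a (s : A))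

/-- Right multiplications, as operators on an ideal. -/
def rightAct {S : Submodule K A} (hS : IsIdeal S) : A →ₗ[K] Module.End K S where
  toFun a := (LinearMap.mulRight K a).restrict fun x hx ↦ (hS a x hx).2
  map_add' a b := LinearMap.ext fun s ↦ Subtype.ext (mul_add (s : A) a b)
  map_smul' r a := LinearMap.ext fun s ↦ Subtype.ext (mul_smul_comm r (s : A) a)

/-- The elements `n a + a n` annihilate `A` from the left. -/
theorem IsLeibniz.mul_add_mul_mul (hA : IsLeibniz A) (n a b : A) :
    (n * a + a * n) * b = 0 := by
  rw [add_mul, hA.mul_mul n a b, hA.mul_mul a n b]; abel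

/-- On a minimal ideal `N` the right action is zero or the negative of the left action: the elements
`n a + a n` span an ideal inside `N`, which is `0` or `N`. -/
theorem IsMinimalIdeal.mul_eq_zero_or_eq_neg (hA : IsLeibniz A) {N : Submodule K A}
    (hN : IsMinimalIdeal N) :
    (∀ n ∈ N, ∀ a, n * a = 0) ∨ (∀ n ∈ N, ∀ a, n * a = -(a * n)) := by
  let Y : Submodule K A := Submodule.span K {y | ∃ n ∈ N, ∃ a, y = n * a + a * n}
  have hYmul : ∀ y ∈ Y, ∀ b, y * b = 0 := by
    intro y hy b
    have : Y ≤ LinearMap.ker (LinearMap.mulRight K b) := Submodule.span_le.mpr (by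
      rintro _ ⟨n, -, a, rfl⟩
      exact hA.mul_add_mul_mul n a b)
    exact this hy
  have hY : IsIdeal Y := by
    intro b y hy
    refine ⟨?_, by rw [hYmul y hy b]; exact Y.zero_mem⟩
    have : Y ≤ Y.comap (LinearMap.mulLeft K b) := Submodule.span_le.mpr (by
      rintro _ ⟨n, hn, a, rfl⟩
      change b * (n * a + a * n) ∈ Y
      have : b * (n * a + a * n) =
          ((b * n) * a + a * (b * n)) + (n * (b * a) + (b * a) * n) := by
        rw [mul_add, hA b n a, hA b a n]; abel
      rw [this]
      exact add_mem (Submodule.subset_span ⟨_, (hN.1 b n hn).1, a, rfl⟩)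
        (Submodule.subset_span ⟨n, hn, _, rfl⟩))
    exact this hy
  have hYN : Y ≤ N := Submodule.span_le.mpr (by
    rintro _ ⟨n, hn, a, rfl⟩
    exact add_mem (hN.1 a n hn).2 (hN.1 a n hn).1)
  rcases hN.2.2 Y hY hYN with h | h
  · right
    intro n hn a
    have : n * a + a * n ∈ Y := Submodule.subset_span ⟨n, hn, a, rfl⟩
    rw [h, Submodule.mem_bot] at this
    exact eq_neg_of_add_eq_zero_left this
  · left
    exact fun n hn a ↦ hYmul n (h ▸ hn) a

variable (K A) in
/-- All left and right multiplications on the abelian socle. -/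
def socleOperators : Set (Module.End K (asoc K A)) :=
  Set.range (leftAct (isIdeal_asoc (K := K) (A := A))) ∪
    Set.range (rightAct (isIdeal_asoc (K := K) (A := A)))

theorem socle_mul_mul_comm (hA : IsLeibniz A) (hsq : square K A ≤ asoc K A) {s : A}
    (hs : s ∈ asoc K A) (a b : A) : a * (b * s) = b * (a * s) := by
  rw [hA a b s, isAbelian_asoc _ (hsq (mul_mem_square a b)) s hs, zero_add]

theorem socle_mul_right_comm (hA : IsLeibniz A) (hsq : square K A ≤ asoc K A) {s : A}
    (hs : s ∈ asoc K A) (a b : A) : (s * a) * b = (s * b) * a := by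
  have : asoc K A ≤ LinearMap.ker (LinearMap.mulRight K b ∘ₗ LinearMap.mulRight K a -
      LinearMap.mulRight K a ∘ₗ LinearMap.mulRight K b) := asoc_le fun N hN hNab n hn ↦ by
    rw [LinearMap.mem_ker]
    change (n * a) * b - (n * b) * a = 0
    rcases hN.mul_eq_zero_or_eq_neg hA with h | h
    · rw [h n hn a, h n hn b, zero_mul, zero_mul, sub_zero]
    · rw [h _ (hN.1 a n hn).2 b, h _ (hN.1 b n hn).2 a, h n hn a, h n hn b, mul_neg, mul_neg,
        neg_neg, neg_neg, socle_mul_mul_comm hA hsq (le_asoc hN hNab hn), sub_self]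
  exact sub_eq_zero.mp (this hs)

theorem socleOperators_comm (hA : IsLeibniz A) (hsq : square K A ≤ asoc K A) :
    ∀ f ∈ socleOperators K A, ∀ g ∈ socleOperators K A, f * g = g * f := by
  have hLR : ∀ a b : A, ∀ s ∈ asoc K A, a * (s * b) = (a * s) * b := fun a b s hs ↦ by
    rw [hA a s b, isAbelian_asoc s hs _ (hsq (mul_mem_square a b)), add_zero]
  rintro _ (⟨a, rfl⟩ | ⟨a, rfl⟩) _ (⟨b, rfl⟩ | ⟨b, rfl⟩) <;>
    refine LinearMap.ext fun s ↦ Subtype.ext ?_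
  · exact socle_mul_mul_comm hA hsq s.2 a b
  · exact hLR a b s s.2
  · exact (hLR b a s s.2).symm
  · exact socle_mul_right_comm hA hsq s.2 b a

/-- A nilpotent operator that commutes with the action vanishes on every minimal ideal, where its
kernel is a nonzero ideal. -/
theorem eq_zero_of_mem_adjoin_socleOperators (hA : IsLeibniz A) (hsq : square K A ≤ asoc K A)
    (q : Module.End K (asoc K A)) (hq : q ∈ Algebra.adjoin K (socleOperators K A))
    (hnil : IsNilpotent q) : q = 0 := by
  let S := asoc K A
  have hcomm : ∀ g ∈ socleOperators K A, ∀ s : S, q (g s) = g (q s) := by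
    intro g hg s
    have hmul := Algebra.isMulCommutative_adjoin K (socleOperators_comm (K := K) hA hsq)
    have := congrArg Subtype.val (hmul.is_comm.comm ⟨q, hq⟩ ⟨g, Algebra.subset_adjoin hg⟩)
    exact LinearMap.congr_fun this s
  suffices h : asoc K A ≤ (LinearMap.ker q).map (asoc K A).subtype by
    refine LinearMap.ext fun s ↦ ?_
    obtain ⟨t, ht, hts⟩ := h s.2
    obtain rfl : t = s := Subtype.ext hts
    exact ht
  refine asoc_le fun N hN hNab ↦ ?_
  have hNS : N ≤ S := le_asoc hN hNab
  have hinv : ∀ g ∈ socleOperators K A, ∀ s ∈ N.comap S.subtype, g s ∈ N.comap S.subtype := by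
    rintro _ (⟨a, rfl⟩ | ⟨a, rfl⟩) s hs
    · exact (hN.1 a s hs).1
    · exact (hN.1 a s hs).2
  have hqN : ∀ s : S, (s : A) ∈ N → (q s : A) ∈ N := fun s hs ↦
    (invariantSubmodule (socleOperators K A) (N.comap S.subtype) hinv).smul_mem ⟨q, hq⟩ hs
  let X : Submodule K A := N ⊓ (LinearMap.ker q).map S.subtype
  have hX : IsIdeal X := by
    rintro a _ ⟨hxN, x, hx, rfl⟩
    have hx' : q x = 0 := hx
    refine ⟨⟨(hN.1 a _ hxN).1, leftAct isIdeal_asoc a x, ?_, rfl⟩,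
      ⟨(hN.1 a _ hxN).2, rightAct isIdeal_asoc a x, ?_, rfl⟩⟩
    · change q _ = 0
      rw [hcomm _ (Or.inl ⟨a, rfl⟩), hx', map_zero]
    · change q _ = 0
      rw [hcomm _ (Or.inr ⟨a, rfl⟩), hx', map_zero]
  rcases hN.2.2 X hX inf_le_left with h | h
  · exfalso
    obtain ⟨k, hk⟩ := hnil
    have hinj : ∀ k : ℕ, ∀ s : S, (s : A) ∈ N → (q ^ k) s = 0 → s = 0 := by
      intro k
      induction k with
      | zero => exact fun s _ hs ↦ hs
      | succ k ih =>
        intro s hs hks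
        rw [pow_succ] at hks
        have hqs : q s = 0 := ih (q s) (hqN s hs) hks
        have hsX : (s : A) ∈ X := ⟨hs, s, hqs, rfl⟩
        rw [h] at hsX
        exact Subtype.ext hsX
    refine hN.2.1 (eq_bot_iff.mpr fun n hn ↦ ?_)
    have := hinj k ⟨n, hNS hn⟩ hn (by rw [hk]; rfl)
    exact congrArg Subtype.val this
  · exact inf_eq_left.mp h

/-- Every subspace of the socle stable under some of the multiplications has a complement that is
stable under the same multiplications. -/
theorem exists_socle_isCompl [FiniteDimensional K A] (hA : IsLeibniz A)
    (hsq : square K A ≤ asoc K A) {G : Set (Module.End K (asoc K A))}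
    (hG : G ⊆ socleOperators K A) (W : Submodule K (asoc K A)) (hW : ∀ g ∈ G, ∀ w ∈ W, g w ∈ W) :
    ∃ W' : Submodule K (asoc K A), (∀ g ∈ G, ∀ w ∈ W', g w ∈ W') ∧ IsCompl W W' :=
  exists_invariant_isCompl (fun f hf g hg ↦ socleOperators_comm hA hsq f (hG hf) g (hG hg))
    (fun q hq ↦ eq_zero_of_mem_adjoin_socleOperators hA hsq q (Algebra.adjoin_mono hG hq)) W hW

end Action

/-! ### Elementarity of algebras that split over their abelian socle -/

section Split

variable {K A : Type*} [Field K] [NonUnitalNonAssocRing A] [Module K A]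
  [IsScalarTower K A A] [SMulCommClass K A A]

theorem square_le_of_isCompl {S : Submodule K A} (hS : IsIdeal S) {C : Submodule K A}
    (hC : IsAbelian C) (h : IsCompl S C) : square K A ≤ S := by
  refine prod_le.mpr fun a _ b _ ↦ ?_
  have ha : a ∈ S ⊔ C := h.sup_eq_top ▸ trivial
  have hb : b ∈ S ⊔ C := h.sup_eq_top ▸ trivial
  obtain ⟨s, hs, c, hc, rfl⟩ := Submodule.mem_sup.mp ha
  obtain ⟨t, ht, d, hd, rfl⟩ := Submodule.mem_sup.mp hb
  rw [add_mul, mul_add c, hC c hc d hd, add_zero]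
  exact add_mem (hS _ s hs).2 (hS c t ht).1

/-- Let `M = T ⊕ D`, where `T` is an abelian ideal of `M`, the products in `D` vanish, and the
maximal `M`-submodules of `T` meet in zero. Each of these together with `D` spans a maximal
subalgebra of `M`. Every hyperplane of `M` that contains `T` contains `M ^ 2` and is a maximal
subalgebra too. All these subalgebras meet in zero. -/
theorem frattiniTrivial_of_complement {M : NonUnitalSubalgebra K A} {T D : Submodule K A}
    (hT : IsIdealOf M T) (hTab : IsAbelian T) (hDM : D ≤ M.toSubmodule) (hDab : IsAbelian D)
    (hTD : T ⊓ D = ⊥) (hsup : T ⊔ D = M.toSubmodule)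
    (hmax : ∀ t ∈ T, t ≠ 0 → ∃ X : Submodule K A, IsIdealOf M X ∧ X ≤ T ∧ t ∉ X ∧
      ∀ Y : Submodule K A, IsIdealOf M Y → Y ≤ T → Y ≤ X ∨ X ⊔ Y = T) :
    FrattiniTrivial M := by
  have hdisj : ∀ x, x ∈ T → x ∈ D → x = 0 := fun x hxT hxD ↦ by
    have : x ∈ T ⊓ D := ⟨hxT, hxD⟩
    rwa [hTD, Submodule.mem_bot] at this
  have hMT : ∀ m ∈ M, ∀ n ∈ M, m * n ∈ T := by
    intro m hm n hn
    have hm' : m ∈ T ⊔ D := hsup ▸ hm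
    have hn' : n ∈ T ⊔ D := hsup ▸ hn
    obtain ⟨t, ht, d, hd, rfl⟩ := Submodule.mem_sup.mp hm'
    obtain ⟨u, hu, e, he, rfl⟩ := Submodule.mem_sup.mp hn'
    rw [add_mul, mul_add d, hDab d hd e he, add_zero]
    exact add_mem (hT.2 _ hn t ht).2 (hT.2 d (hDM hd) u hu).1
  intro I hI hIU
  rw [eq_bot_iff]
  intro x hx
  have hxM := hI.1 hx
  have hx' : x ∈ T ⊔ D := hsup ▸ hxM
  obtain ⟨t, ht, d, hd, rfl⟩ := Submodule.mem_sup.mp hx'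
  have ht0 : t = 0 := by
    by_contra hne
    obtain ⟨X, hX, hXT, htX, hXmax⟩ := hmax t ht hne
    let D' : NonUnitalSubalgebra K A := D.toNonUnitalSubalgebra fun a b ha hb ↦ by
      rw [hDab a ha b hb]; exact D.zero_mem
    let U : NonUnitalSubalgebra K A := supSubalgebra X D' (fun u hu ↦ hX.2 u (hDM hu))
      (fun a ha b hb ↦ (hX.2 a (hX.1 ha) b hb).1)
    have hU : ∀ y, y ∈ U ↔ y ∈ X ⊔ D := fun y ↦ Iff.rfl
    have htU : t ∉ U := by
      intro h
      obtain ⟨a, ha, e, he, hae⟩ := Submodule.mem_sup.mp ((hU t).mp h)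
      have he0 : e = 0 := hdisj e (by rw [← eq_sub_iff_add_eq'] at hae; rw [hae];
                                      exact sub_mem ht (hXT ha)) he
      rw [he0, add_zero] at hae
      exact htX (hae ▸ ha)
    have hcov : U ⋖ M := by
      refine ⟨lt_of_le_of_ne (fun y hy ↦ (sup_le hX.1 hDM : X ⊔ D ≤ _) ((hU y).mp hy))
        (fun h ↦ htU (h ▸ hT.1 ht)), fun Y hUY hYM ↦ ?_⟩
      have hDY : D ≤ Y.toSubmodule := fun y hy ↦
        hUY.le ((hU y).mpr (Submodule.mem_sup_right hy))
      have hXY : X ≤ Y.toSubmodule := fun y hy ↦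
        hUY.le ((hU y).mpr (Submodule.mem_sup_left hy))
      -- `Y ∩ T` is an ideal of `M = T + D`, since `T` annihilates it and `D ⊆ Y`
      have hYT : IsIdealOf M (Y.toSubmodule ⊓ T) := by
        refine ⟨inf_le_right.trans hT.1, fun m hm y hy ↦ ?_⟩
        have hyM := hT.1 hy.2
        refine ⟨⟨?_, hMT m hm y hyM⟩, ⟨?_, hMT y hyM m hm⟩⟩
        all_goals
          have hm' : m ∈ T ⊔ D := hsup ▸ hm
          obtain ⟨a, ha, e, he, rfl⟩ := Submodule.mem_sup.mp hm'
        · rw [add_mul, hTab a ha y hy.2, zero_add]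
          exact Y.mul_mem (hDY he) hy.1
        · rw [mul_add, hTab y hy.2 a ha, zero_add]
          exact Y.mul_mem hy.1 (hDY he)
      rcases hXmax _ hYT inf_le_right with h | h
      · refine hUY.not_ge fun y hy ↦ ?_
        have hy' : y ∈ T ⊔ D := hsup ▸ hYM.le hy
        obtain ⟨a, ha, e, he, rfl⟩ := Submodule.mem_sup.mp hy'
        exact (hU _).mpr (Submodule.add_mem_sup
          (h ⟨(Y.toSubmodule.add_mem_iff_left (hDY he)).mp hy, ha⟩) he)
      · refine hYM.not_ge fun y hy ↦ ?_
        have : T ⊔ D ≤ Y.toSubmodule := sup_le (h ▸ sup_le hXY inf_le_left) hDY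
        exact this (hsup ▸ hy)
    have hxU : t + d ∈ U := hIU U hcov hx
    exact htU ((U.toSubmodule.add_mem_iff_left
      ((hU d).mpr (Submodule.mem_sup_right hd))).mp hxU)
  subst ht0
  rw [zero_add] at hx hxM ⊢
  rw [Submodule.mem_bot]
  by_contra hne
  have hdT : d ∉ T := fun h ↦ hne (hdisj d h hd)
  obtain ⟨φ, hφd, hφT⟩ := Submodule.exists_le_ker_of_notMem hdT
  let U : NonUnitalSubalgebra K A := (M.toSubmodule ⊓ LinearMap.ker φ).toNonUnitalSubalgebra
    fun a b ha hb ↦ ⟨M.mul_mem ha.1 hb.1, hφT (hMT a ha.1 b hb.1)⟩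
  have hcov : U ⋖ M := by
    refine ⟨lt_of_le_of_ne (fun y hy ↦ hy.1) fun h ↦ ?_, fun Y hUY hYM ↦ ?_⟩
    · have : d ∈ U := h ▸ hxM
      exact hφd this.2
    · obtain ⟨y, hyY, hyU⟩ := SetLike.exists_of_lt hUY
      have hφy : φ y ≠ 0 := fun h ↦ hyU ⟨hYM.le hyY, h⟩
      refine hYM.not_ge fun m hm ↦ ?_
      have hmU : m - (φ m / φ y) • y ∈ U := by
        refine ⟨sub_mem hm (M.toSubmodule.smul_mem _ (hYM.le hyY)), ?_⟩
        rw [SetLike.mem_coe, LinearMap.mem_ker, map_sub, map_smul, smul_eq_mul,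
          div_mul_cancel₀ _ hφy, sub_self]
      exact (Y.toSubmodule.sub_mem_iff_left (Y.toSubmodule.smul_mem _ hyY)).mp (hUY.le hmU)
  have : d ∈ U := hIU U hcov hx
  exact hφd this.2

theorem frattiniTrivial_of_isCompl [FiniteDimensional K A] (hA : IsLeibniz A)
    {C : NonUnitalSubalgebra K A} (hC : IsAbelian C.toSubmodule)
    (hcompl : IsCompl (asoc K A) C.toSubmodule) (M : NonUnitalSubalgebra K A) :
    FrattiniTrivial M := by
  have hsq := square_le_of_isCompl isIdeal_asoc hC hcompl
  let S := asoc K A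
  let T : Submodule K A := M.toSubmodule ⊓ S
  let G : Set (Module.End K S) := leftAct isIdeal_asoc '' M ∪ rightAct isIdeal_asoc '' M
  have hG : G ⊆ socleOperators K A :=
    Set.union_subset_union (Set.image_subset_range _ _) (Set.image_subset_range _ _)
  have hTideal : IsIdealOf M T := ⟨inf_le_left, fun m hm x hx ↦
    ⟨⟨M.mul_mem hm hx.1, (isIdeal_asoc m x hx.2).1⟩,
      ⟨M.mul_mem hx.1 hm, (isIdeal_asoc m x hx.2).2⟩⟩⟩
  have hTab : IsAbelian T := isAbelian_asoc.mono inf_le_right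
  have hinv : ∀ Y : Submodule K A, (∀ m ∈ M, ∀ x ∈ Y, m * x ∈ Y ∧ x * m ∈ Y) →
      ∀ g ∈ G, ∀ w ∈ Y.comap S.subtype, g w ∈ Y.comap S.subtype := by
    rintro Y hY _ (⟨m, hm, rfl⟩ | ⟨m, hm, rfl⟩) w hw
    · exact (hY m hm w hw).1
    · exact (hY m hm w hw).2
  obtain ⟨W, hW, hTW⟩ := exists_socle_isCompl hA hsq hG (T.comap S.subtype) (hinv T hTideal.2)
  -- a complement `D` of `T` in `M`, where `W` is a complement of `T` in the socle
  let D : Submodule K A := M.toSubmodule ⊓ (W.map S.subtype ⊔ C.toSubmodule)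
  have hTW0 : ∀ x ∈ T, x ∈ W.map S.subtype → x = 0 := by
    rintro _ hx ⟨w, hw, rfl⟩
    have := Submodule.disjoint_def.mp hTW.disjoint w hx hw
    rw [this, map_zero]
  have hTD : ∀ x ∈ T, x ∈ D → x = 0 := by
    intro x hx hxD
    obtain ⟨w, hw, c, hc, hwc⟩ := Submodule.mem_sup.mp hxD.2
    have hwS : w ∈ S := Submodule.map_subtype_le S W hw
    have hc0 : c = 0 := Submodule.disjoint_def.mp hcompl.disjoint c
      (by rw [← eq_sub_iff_add_eq'] at hwc; rw [hwc]; exact sub_mem hx.2 hwS) hc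
    rw [hc0, add_zero] at hwc
    exact hTW0 x hx (hwc ▸ hw)
  -- `W` is stable under the components in `C` of the elements of `M`
  have hCW : ∀ w ∈ W.map S.subtype, ∀ c ∈ C, w + c ∈ M → ∀ u ∈ W.map S.subtype,
      c * u ∈ W.map S.subtype ∧ u * c ∈ W.map S.subtype := by
    intro w hw c hc hm u hu
    have hwS : w ∈ S := Submodule.map_subtype_le S W hw
    have huS : u ∈ S := Submodule.map_subtype_le S W hu
    have h1 : c * u = (w + c) * u := by rw [add_mul, isAbelian_asoc w hwS u huS, zero_add]
    have h2 : u * c = u * (w + c) := by rw [mul_add, isAbelian_asoc u huS w hwS, zero_add]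
    obtain ⟨v, hv, rfl⟩ := hu
    rw [h1, h2]
    exact ⟨⟨_, hW _ (Or.inl ⟨_, hm, rfl⟩) v hv, rfl⟩, ⟨_, hW _ (Or.inr ⟨_, hm, rfl⟩) v hv, rfl⟩⟩
  have hDab : IsAbelian D := by
    intro x hx y hy
    refine hTD _ ⟨M.mul_mem hx.1 hy.1, hsq (mul_mem_square x y)⟩ ⟨M.mul_mem hx.1 hy.1, ?_⟩
    obtain ⟨w, hw, c, hc, rfl⟩ := Submodule.mem_sup.mp hx.2
    obtain ⟨v, hv, e, he, rfl⟩ := Submodule.mem_sup.mp hy.2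
    refine Submodule.mem_sup_left ?_
    rw [add_mul, mul_add, mul_add, hC c hc e he, add_zero,
      isAbelian_asoc w (Submodule.map_subtype_le S W hw) v (Submodule.map_subtype_le S W hv),
      zero_add]
    exact add_mem (hCW v hv e he hy.1 w hw).2 (hCW w hw c hc hx.1 v hv).1
  refine frattiniTrivial_of_complement hTideal hTab inf_le_left hDab
    (eq_bot_iff.mpr fun x hx ↦ hTD x hx.1 hx.2)
    (le_antisymm (sup_le inf_le_left inf_le_left) fun m hm ↦ ?_) fun t ht hne ↦ ?_
  · have hm' : m ∈ S ⊔ C.toSubmodule := hcompl.sup_eq_top ▸ trivial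
    obtain ⟨s, hs, c, hc, rfl⟩ := Submodule.mem_sup.mp hm'
    have hs' : (⟨s, hs⟩ : S) ∈ T.comap S.subtype ⊔ W := hTW.sup_eq_top ▸ trivial
    obtain ⟨t, ht, w, hw, htw⟩ := Submodule.mem_sup.mp hs'
    have htw' : (t : A) + w = s := congrArg Subtype.val htw
    have htM : (t : A) ∈ M.toSubmodule := ht.1
    rw [← htw', add_assoc] at hm ⊢
    exact Submodule.add_mem_sup ht ⟨(M.toSubmodule.add_mem_iff_right htM).mp hm,
      Submodule.add_mem_sup ⟨w, hw, rfl⟩ hc⟩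
  · have hne' : (⟨t, ht.2⟩ : S) ≠ 0 := fun h ↦ hne (congrArg Subtype.val h)
    obtain ⟨X, hX, htX, hXmax⟩ := exists_maximal_invariant
      (fun f hf g hg ↦ socleOperators_comm hA hsq f (hG hf) g (hG hg))
      (fun q hq ↦ eq_zero_of_mem_adjoin_socleOperators hA hsq q (Algebra.adjoin_mono hG hq)) hne'
    refine ⟨T ⊓ X.map S.subtype, ⟨inf_le_left.trans inf_le_left, ?_⟩, inf_le_left, ?_, ?_⟩
    · rintro m hm _ ⟨hxT, x, hx, rfl⟩
      exact ⟨⟨(hTideal.2 m hm _ hxT).1, _, hX _ (Or.inl ⟨m, hm, rfl⟩) x hx, rfl⟩,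
        ⟨(hTideal.2 m hm _ hxT).2, _, hX _ (Or.inr ⟨m, hm, rfl⟩) x hx, rfl⟩⟩
    · rintro ⟨-, x, hx, hxt⟩
      obtain rfl : x = ⟨t, ht.2⟩ := Subtype.ext hxt
      exact htX hx
    · intro Y hY hYT
      rcases hXmax _ (hinv Y hY.2) with h | h
      · exact Or.inl fun y hy ↦ ⟨hYT hy, ⟨y, (hYT hy).2⟩, h hy, rfl⟩
      · refine Or.inr (le_antisymm (sup_le inf_le_left hYT) fun u hu ↦ ?_)
        have hu' : (⟨u, hu.2⟩ : S) ∈ X ⊔ Y.comap S.subtype := h ▸ trivial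
        obtain ⟨x, hx, y, hy, hxy⟩ := Submodule.mem_sup.mp hu'
        have hxy' : (x : A) + y = u := congrArg Subtype.val hxy
        refine hxy' ▸ Submodule.add_mem_sup ⟨?_, x, hx, rfl⟩ hy
        exact (T.add_mem_iff_left (hYT hy)).mp (hxy' ▸ hu)

end Split

/-! ### Solvable elementary algebras -/

section Elementary

attribute [local instance] LieRing.ofAssociativeRing

variable {K A : Type*} [Field K] [NonUnitalNonAssocRing A] [Module K A]
  [IsScalarTower K A A] [SMulCommClass K A A]

theorem leftAct_mul (hA : IsLeibniz A) {S : Submodule K A} (hS : IsIdeal S) (a b : A) :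
    leftAct hS (a * b) = ⁅leftAct hS a, leftAct hS b⁆ :=
  LinearMap.ext fun s ↦ Subtype.ext (hA.mul_mul a b s)

/-- Squares span an ideal that annihilates `A` from the left; it is abelian, so it lies in the
abelian socle. -/
theorem mul_self_mem_asoc [FiniteDimensional K A] (hA : IsLeibniz A)
    (hΦ : FrattiniTrivial (⊤ : NonUnitalSubalgebra K A)) (x : A) : x * x ∈ asoc K A := by
  let Y : Submodule K A := Submodule.span K (Set.range fun y : A ↦ y * y)
  have hYmul : ∀ y ∈ Y, ∀ b, y * b = 0 := by
    intro y hy b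
    have : Y ≤ LinearMap.ker (LinearMap.mulRight K b) := Submodule.span_le.mpr (by
      rintro _ ⟨z, rfl⟩
      change (z * z) * b = 0
      rw [hA.mul_mul, sub_self])
    exact this hy
  have hY : IsIdeal Y := by
    intro b y hy
    refine ⟨?_, by rw [hYmul y hy b]; exact Y.zero_mem⟩
    have : Y ≤ Y.comap (LinearMap.mulLeft K b) := Submodule.span_le.mpr (by
      rintro _ ⟨z, rfl⟩
      change b * (z * z) ∈ Y
      have : b * (z * z) = (b * z + z) * (b * z + z) - (b * z) * (b * z) - z * z := by
        rw [hA b z z, add_mul, mul_add, mul_add]; abel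
      rw [this]
      exact sub_mem (sub_mem (Submodule.subset_span ⟨_, rfl⟩) (Submodule.subset_span ⟨_, rfl⟩))
        (Submodule.subset_span ⟨_, rfl⟩))
    exact this hy
  exact hΦ.le_asoc hY (fun y hy z _ ↦ hYmul y hy z) (Submodule.subset_span ⟨x, rfl⟩)

/-- Let `S` be an abelian ideal of `A` and `x * x = 0`. If the Frattini ideal of `S + K x` vanishes,
then `x` acts semisimply on `S`. Indeed, the image of the nilpotent part `n` of the action is an
abelian ideal of `S + K x`, hence is complemented; `n` kills the part of the complement in `S`, so
its image equals the image of `n ^ 2`. -/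
theorem isSemisimple_leftAct [PerfectField K] [FiniteDimensional K A] (hA : IsLeibniz A)
    {S : Submodule K A} (hS : IsIdeal S) (hSab : IsAbelian S) {x : A} (hx : x * x = 0)
    {M : NonUnitalSubalgebra K A} (hM : FrattiniTrivial M) (hSM : S ≤ M.toSubmodule) (hxM : x ∈ M)
    (hMle : M.toSubmodule ≤ S ⊔ Submodule.span K {x}) : (leftAct hS x).IsSemisimple := by
  obtain ⟨n, hn, s, -, hnil, hss, hns⟩ := (leftAct hS x).exists_isNilpotent_isSemisimple
  suffices h0 : n = 0 by rwa [hns, h0, zero_add]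
  have hleft : ∀ u : S, leftAct hS x (n u) = n (leftAct hS x u) := fun u ↦
    LinearMap.congr_fun (Algebra.commute_of_mem_adjoin_self hn).eq u
  have hLR : Commute (rightAct hS x) (leftAct hS x) := by
    refine LinearMap.ext fun u ↦ Subtype.ext ?_
    change (x * u) * x = x * (u * x)
    rw [hA x u x, hx, mul_zero, add_zero]
  have hright : ∀ u : S, rightAct hS x (n u) = n (rightAct hS x u) := fun u ↦
    LinearMap.congr_fun (Algebra.commute_of_mem_adjoin_singleton_of_commute hn hLR).eq u
  let W : Submodule K A := (LinearMap.range n).map S.subtype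
  have hWS : W ≤ S := Submodule.map_subtype_le S _
  have hW : IsIdealOf M W := by
    refine ⟨hWS.trans hSM, ?_⟩
    rintro m hm _ ⟨_, ⟨u, rfl⟩, rfl⟩
    obtain ⟨t, ht, y, hy, rfl⟩ := Submodule.mem_sup.mp (hMle hm)
    obtain ⟨r, rfl⟩ := Submodule.mem_span_singleton.mp hy
    simp only [Submodule.subtype_apply]
    constructor
    · rw [add_mul, hSab t ht _ (n u).2, zero_add, smul_mul_assoc]
      exact W.smul_mem r ⟨_, ⟨_, (hleft u).symm⟩, rfl⟩
    · rw [mul_add, hSab _ (n u).2 t ht, zero_add, mul_smul_comm]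
      exact W.smul_mem r ⟨_, ⟨_, (hright u).symm⟩, rfl⟩
  obtain ⟨D, -, hinf, hsup⟩ := hM.exists_complement hW (hSab.mono hWS)
  have hDinv : ∀ g ∈ ({leftAct hS x} : Set (Module.End K S)),
      ∀ t ∈ D.toSubmodule.comap S.subtype, g t ∈ D.toSubmodule.comap S.subtype := by
    rintro _ rfl t ht
    have hx' : x ∈ W ⊔ D.toSubmodule := hsup ▸ hxM
    obtain ⟨w, hw, d, hd, rfl⟩ := Submodule.mem_sup.mp hx'
    change (w + d) * (t : A) ∈ D
    rw [add_mul, hSab w (hWS hw) t t.2, zero_add]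
    exact D.mul_mem hd ht
  have hnD : ∀ t : S, (t : A) ∈ D → n t = 0 := by
    intro t ht
    have h1 : (n t : A) ∈ D :=
      (invariantSubmodule _ _ hDinv).smul_mem ⟨n, hn⟩ ht
    have h2 : (n t : A) ∈ W ⊓ D.toSubmodule := ⟨⟨n t, ⟨t, rfl⟩, rfl⟩, h1⟩
    rw [hinf] at h2
    exact Subtype.ext h2
  have hsq : ∀ u : S, ∃ v : S, n u = n (n v) := by
    intro u
    have hu : (u : A) ∈ W ⊔ D.toSubmodule := hsup ▸ hSM u.2
    obtain ⟨_, ⟨_, ⟨v, rfl⟩, rfl⟩, d, hd, hu⟩ := Submodule.mem_sup.mp hu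
    refine ⟨v, ?_⟩
    have hdu : ((u - n v : S) : A) = d := by
      rw [Submodule.coe_sub, ← hu]
      exact add_sub_cancel_left _ _
    have := hnD (u - n v) (hdu ▸ hd)
    rwa [map_sub, sub_eq_zero] at this
  have hpow : ∀ k : ℕ, ∀ u : S, ∃ v : S, n u = (n ^ k) v := by
    intro k
    induction k with
    | zero => exact fun u ↦ ⟨n u, rfl⟩
    | succ k ih =>
      intro u
      obtain ⟨v, hv⟩ := hsq u
      obtain ⟨w, hw⟩ := ih v
      refine ⟨w, ?_⟩
      rw [hv, hw, pow_succ']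
      rfl
  obtain ⟨k, hk⟩ := hnil
  refine LinearMap.ext fun u ↦ ?_
  obtain ⟨v, hv⟩ := hpow k u
  rw [hv, hk]
  rfl

/-- If `x` acts semisimply on `S`, so does `ad x` on `End S`; hence `x (x (x c)) = 0` forces `x c`
to act trivially. -/
theorem leftAct_mul_eq_zero [PerfectField K] [FiniteDimensional K A] (hA : IsLeibniz A)
    {S : Submodule K A} (hS : IsIdeal S) {x c : A} (hx : (leftAct hS x).IsSemisimple)
    (hc : x * (x * (x * c)) = 0) : leftAct hS (x * c) = 0 := by
  have had := (LieAlgebra.ad_isSemisimple_of_isSemisimple hx).isFinitelySemisimple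
  have heq := had.genEigenspace_eq_eigenspace 0 (k := ((3 : ℕ) : ℕ∞)) (by norm_num)
  rw [Module.End.genEigenspace_zero_nat, Module.End.eigenspace_zero] at heq
  have hmem : leftAct hS c ∈
      LinearMap.ker (LieAlgebra.ad K (Module.End K S) (leftAct hS x) ^ 3) := by
    change ⁅leftAct hS x, ⁅leftAct hS x, ⁅leftAct hS x, leftAct hS c⁆⁆⁆ = 0
    rw [← leftAct_mul hA, ← leftAct_mul hA, ← leftAct_mul hA, hc, map_zero]
  rw [heq] at hmem
  rw [leftAct_mul hA]
  exact hmem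

/-- If `Φ(A) = 0` and `A` is solvable, a complement of the abelian socle acts faithfully on it: the
kernel of the action together with the socle would span a nilpotent, hence abelian, ideal. -/
theorem eq_zero_of_mul_asoc_eq_zero [FiniteDimensional K A] (hA : IsLeibniz A)
    (hsolv : IsSolvableAlg K A) (hΦ : FrattiniTrivial (⊤ : NonUnitalSubalgebra K A))
    {C : NonUnitalSubalgebra K A} (hC : IsCompl (asoc K A) C.toSubmodule)
    (hskew : ∀ c ∈ C, ∀ d ∈ C, c * d = -(d * c)) {z : A} (hz : z ∈ C)
    (hzS : ∀ s ∈ asoc K A, z * s = 0) : z = 0 := by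
  obtain ⟨n, hn⟩ := hsolv
  have hS : IsIdeal (asoc K A) := isIdeal_asoc
  have hSab : IsAbelian (asoc K A) := isAbelian_asoc
  suffices h : ∀ j k, k + j = n → ∀ z ∈ C, z ∈ derivedSeries K A k →
      (∀ s ∈ asoc K A, z * s = 0) → z = 0 from h n 0 (zero_add n) z hz trivial hzS
  intro j
  induction j with
  | zero =>
    rintro k rfl z - hzk -
    rw [add_zero] at hn
    rwa [hn, Submodule.mem_bot] at hzk
  | succ j ih =>
    intro k hk z hz hzk hzS
    let Z : Submodule K A :=
      { carrier := {z | ∀ s ∈ asoc K A, z * s = 0}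
        add_mem' := fun ha hb s hs ↦ by rw [add_mul, ha s hs, hb s hs, add_zero]
        zero_mem' := fun s _ ↦ zero_mul s
        smul_mem' := fun r a ha s hs ↦ by rw [smul_mul_assoc, ha s hs, smul_zero] }
    let J : Submodule K A := C.toSubmodule ⊓ derivedSeries K A k ⊓ Z
    have hCJ : ∀ c ∈ C, ∀ z ∈ J, c * z ∈ J := by
      rintro c hc z ⟨⟨hzC, hzk⟩, hzZ⟩
      refine ⟨⟨C.mul_mem hc hzC, (isIdeal_derivedSeries hA k c z hzk).1⟩, fun s hs ↦ ?_⟩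
      rw [hA.mul_mul, hzZ s hs, hzZ _ (hS c s hs).1, mul_zero, sub_zero]
    have hJJ : ∀ y ∈ J, ∀ z ∈ J, y * z = 0 := fun y hy z hz ↦
      ih (k + 1) (by omega) _ (C.mul_mem hy.1.1 hz.1.1) (mul_mem_prod hy.1.2 hz.1.2)
        (hCJ y hy.1.1 z hz).2
    have hI : IsIdeal (asoc K A ⊔ J) := by
      intro a x hx
      have ha : a ∈ asoc K A ⊔ C.toSubmodule := hC.sup_eq_top ▸ trivial
      obtain ⟨s, hs, c, hc, rfl⟩ := Submodule.mem_sup.mp ha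
      obtain ⟨t, ht, z, hz, rfl⟩ := Submodule.mem_sup.mp hx
      constructor
      · rw [mul_add, add_mul s c z, ← add_assoc]
        exact Submodule.add_mem_sup (add_mem (hS _ t ht).1 (hS z s hs).2) (hCJ c hc z hz)
      · rw [add_mul, mul_add z s c, ← add_assoc, hskew z hz.1.1 c hc]
        exact Submodule.add_mem_sup (add_mem (hS _ t ht).2 (hS z s hs).1) (neg_mem (hCJ c hc z hz))
    have hII : prod (asoc K A ⊔ J) (asoc K A ⊔ J) ≤ asoc K A := by
      refine prod_le.mpr fun x hx y hy ↦ ?_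
      obtain ⟨s, hs, z, hz, rfl⟩ := Submodule.mem_sup.mp hx
      obtain ⟨t, ht, w, hw, rfl⟩ := Submodule.mem_sup.mp hy
      rw [add_mul, mul_add z, hJJ z hz w hw, add_zero]
      exact add_mem (hS _ s hs).2 (hS z t ht).1
    have hnil : IsNilpotentSub (asoc K A ⊔ J) := by
      refine ⟨2, eq_bot_iff.mpr (prod_le.mpr fun x hx y hy ↦ ?_)⟩
      obtain ⟨s, hs, z, hz, rfl⟩ := Submodule.mem_sup.mp hx
      rw [Submodule.mem_bot, add_mul, hSab s hs y (hII hy), hz.2 y (hII hy), add_zero]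
    have hle := hΦ.le_asoc hI (hΦ.isAbelian_of_isNilpotent hA hI hnil)
    exact Submodule.disjoint_def.mp hC.disjoint z
      (hle (Submodule.mem_sup_right ⟨⟨hz, hzk⟩, hzS⟩)) hz

theorem exists_abelian_isCompl_of_isElementary [PerfectField K] [FiniteDimensional K A]
    (hA : IsLeibniz A) (hsolv : IsSolvableAlg K A)
    (hel : ∀ M : NonUnitalSubalgebra K A, FrattiniTrivial M) :
    ∃ C : NonUnitalSubalgebra K A, IsAbelian C.toSubmodule ∧
      IsCompl (asoc K A) C.toSubmodule := by
  have hΦ := hel ⊤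
  obtain ⟨C, hC⟩ := exists_asoc_isCompl hΦ
  refine ⟨C, ?_, hC⟩
  have hsq : ∀ c ∈ C, c * c = 0 := fun c hc ↦
    Submodule.disjoint_def.mp hC.disjoint _ (mul_self_mem_asoc hA hΦ c) (C.mul_mem hc hc)
  have hskew : ∀ c ∈ C, ∀ d ∈ C, c * d = -(d * c) := by
    intro c hc d hd
    have h := hsq _ (C.add_mem hc hd)
    rw [add_mul, mul_add, mul_add, hsq c hc, hsq d hd, zero_add, add_zero] at h
    exact eq_neg_of_add_eq_zero_left h
  have hss : ∀ x ∈ C, (leftAct (isIdeal_asoc (K := K) (A := A)) x).IsSemisimple := by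
    intro x hx
    let X : NonUnitalSubalgebra K A := (Submodule.span K {x}).toNonUnitalSubalgebra
      fun a b ha hb ↦ by
        obtain ⟨r, rfl⟩ := Submodule.mem_span_singleton.mp ha
        obtain ⟨r', rfl⟩ := Submodule.mem_span_singleton.mp hb
        rw [smul_mul_assoc, mul_smul_comm, hsq x hx, smul_zero, smul_zero]
        exact zero_mem _
    exact isSemisimple_leftAct hA isIdeal_asoc isAbelian_asoc (hsq x hx)
      (hel (supSubalgebra (asoc K A) X (fun u _ s hs ↦ isIdeal_asoc u s hs)
        (fun s hs t _ ↦ (isIdeal_asoc t s hs).2)))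
      le_sup_left ((le_sup_right : X.toSubmodule ≤ asoc K A ⊔ X.toSubmodule)
        (Submodule.mem_span_singleton_self x)) le_rfl
  obtain ⟨n, hn⟩ := id hsolv
  -- `C ∩ A ^ (k)` is central in `C`, by downward induction on `k`
  suffices h : ∀ j k, k + j = n → ∀ x ∈ C, x ∈ derivedSeries K A k → ∀ c ∈ C, x * c = 0 from
    fun x hx c hc ↦ h n 0 (zero_add n) x hx trivial c hc
  intro j
  induction j with
  | zero =>
    rintro k rfl x - hxk c -
    rw [add_zero] at hn
    rw [hn, Submodule.mem_bot] at hxk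
    rw [hxk, zero_mul]
  | succ j ih =>
    intro k hk x hx hxk c hc
    have hxc := C.mul_mem hx hc
    have hxxc := C.mul_mem hx hxc
    have h3 : x * (x * (x * c)) = 0 := by
      rw [hskew x hx _ hxxc, ih (k + 1) (by omega) _ hxxc
        (mul_mem_prod hxk (isIdeal_derivedSeries hA k c x hxk).2) x hx, neg_zero]
    have hact := leftAct_mul_eq_zero hA isIdeal_asoc (hss x hx) h3
    exact eq_zero_of_mul_asoc_eq_zero hA hsolv hΦ hC hskew hxc fun s hs ↦
      congrArg Subtype.val (LinearMap.congr_fun hact ⟨s, hs⟩)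

end Elementary

/-! ### Algebras of type I -/

section TypeOne

attribute [local instance] LieRing.ofAssociativeRing

variable {K A : Type*} [Field K] [NonUnitalNonAssocRing A] [Module K A]
  [IsScalarTower K A A] [SMulCommClass K A A]

/-- If `Φ(A) = 0`, an abelian complement of the abelian socle acts faithfully on it, since the
kernel of the action is central and therefore lies in the socle. -/
theorem eq_zero_of_leftAct_eq_zero [FiniteDimensional K A] (hA : IsLeibniz A)
    (hΦ : FrattiniTrivial (⊤ : NonUnitalSubalgebra K A)) {C : NonUnitalSubalgebra K A}
    (hC : IsAbelian C.toSubmodule) (hcompl : IsCompl (asoc K A) C.toSubmodule) {c : A}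
    (hc : c ∈ C) (hcS : leftAct (isIdeal_asoc (K := K) (A := A)) c = 0) : c = 0 := by
  have hl : ∀ s ∈ asoc K A, c * s = 0 := fun s hs ↦
    congrArg Subtype.val (LinearMap.congr_fun hcS ⟨s, hs⟩)
  have hr : ∀ s ∈ asoc K A, s * c = 0 := by
    intro s hs
    have : asoc K A ≤ LinearMap.ker (LinearMap.mulRight K c) := asoc_le fun N hN hNab n hn ↦ by
      change n * c = 0
      rcases hN.mul_eq_zero_or_eq_neg hA with h | h
      · exact h n hn c
      · rw [h n hn c, hl n (le_asoc hN hNab hn), neg_zero]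
    exact this hs
  have hcentral : ∀ a, a * c = 0 ∧ c * a = 0 := by
    intro a
    have ha : a ∈ asoc K A ⊔ C.toSubmodule := hcompl.sup_eq_top ▸ trivial
    obtain ⟨s, hs, d, hd, rfl⟩ := Submodule.mem_sup.mp ha
    rw [add_mul, mul_add, hr s hs, hl s hs, hC d hd c hc, hC c hc d hd, add_zero]
    exact ⟨rfl, rfl⟩
  have hle : Submodule.span K {c} ≤ asoc K A := by
    refine hΦ.le_asoc (fun a x hx ↦ ?_) fun x hx y hy ↦ ?_
    · obtain ⟨r, rfl⟩ := Submodule.mem_span_singleton.mp hx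
      rw [mul_smul_comm, smul_mul_assoc, (hcentral a).1, (hcentral a).2, smul_zero]
      exact ⟨zero_mem _, zero_mem _⟩
    · obtain ⟨r, rfl⟩ := Submodule.mem_span_singleton.mp hx
      rw [smul_mul_assoc, (hcentral y).2, smul_zero]
  exact Submodule.disjoint_def.mp hcompl.disjoint c (hle (Submodule.mem_span_singleton_self c)) hc

/-- The Lie algebra of operators induced on an ideal by left multiplications. -/
def leftActRange (hA : IsLeibniz A) {S : Submodule K A} (hS : IsIdeal S) :
    LieSubalgebra K (Module.End K S) where
  __ := LinearMap.range (leftAct hS)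
  lie_mem' := by
    rintro _ _ ⟨a, rfl⟩ ⟨b, rfl⟩
    exact ⟨a * b, leftAct_mul hA hS a b⟩

/-- A subspace of an ideal that is stable under left multiplications, as a Lie submodule. -/
def lieSubmoduleOfInvariant (hA : IsLeibniz A) {S : Submodule K A} (hS : IsIdeal S)
    (W : Submodule K S) (hW : ∀ a : A, ∀ w ∈ W, leftAct hS a w ∈ W) :
    LieSubmodule K (leftActRange hA hS) S where
  __ := W
  lie_mem := by
    rintro ⟨_, a, rfl⟩ w hw
    exact hW a w hw

theorem complementedLattice_socle [FiniteDimensional K A] (hA : IsLeibniz A)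
    (hsq : square K A ≤ asoc K A) :
    ComplementedLattice (LieSubmodule K (leftActRange hA (isIdeal_asoc (K := K) (A := A)))
      (asoc K A)) := by
  refine ⟨fun W ↦ ?_⟩
  obtain ⟨W', hW', h⟩ := exists_socle_isCompl hA hsq
    (G := Set.range (leftAct isIdeal_asoc)) Set.subset_union_left W.toSubmodule (by
      rintro _ ⟨a, rfl⟩ w hw
      exact W.lie_mem (x := (⟨_, a, rfl⟩ : leftActRange hA isIdeal_asoc)) hw)
  refine ⟨lieSubmoduleOfInvariant hA isIdeal_asoc W' fun a ↦ hW' _ ⟨a, rfl⟩, ?_⟩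
  rw [← LieSubmodule.isCompl_toSubmodule]
  exact h

/-- An algebra that splits over its abelian socle with abelian complement is of type I. In the
decomposition of the socle `V₂` consists of the elements that annihilate `A` from the left, and
`V₁` is a complementary ideal. -/
theorem isTypeOne_of_isCompl [FiniteDimensional K A] (hA : IsLeibniz A)
    {C : NonUnitalSubalgebra K A} (hC : IsAbelian C.toSubmodule)
    (hcompl : IsCompl (asoc K A) C.toSubmodule) :
    IsTypeOne K (⊤ : NonUnitalSubalgebra K A) := by
  have hΦ := frattiniTrivial_of_isCompl hA hC hcompl ⊤
  have hsq := square_le_of_isCompl isIdeal_asoc hC hcompl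
  let S := asoc K A
  have hS : IsIdeal S := isIdeal_asoc
  have hSab : IsAbelian S := isAbelian_asoc
  let Z : Submodule K A :=
    { carrier := {z | ∀ a, z * a = 0}
      add_mem' := fun ha hb s ↦ by rw [add_mul, ha s, hb s, add_zero]
      zero_mem' := fun s ↦ zero_mul s
      smul_mem' := fun r a ha s ↦ by rw [smul_mul_assoc, ha s, smul_zero] }
  have hZ : IsIdeal Z := fun a z hz ↦
    ⟨fun b ↦ by rw [hA.mul_mul, hz b, hz (a * b), mul_zero, sub_zero],
      by rw [hz a]; exact Z.zero_mem⟩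
  obtain ⟨X, hX, hZX⟩ := exists_socle_isCompl hA hsq subset_rfl (Z.comap S.subtype) (by
    rintro _ (⟨a, rfl⟩ | ⟨a, rfl⟩) w hw
    · exact (hZ a w hw).1
    · exact (hZ a w hw).2)
  have hXneg : ∀ x ∈ X, ∀ a : A, (x : A) * a = -(a * x) := by
    intro x hx a
    have hmem : rightAct hS a x + leftAct hS a x ∈ X :=
      add_mem (hX _ (Or.inr ⟨a, rfl⟩) x hx) (hX _ (Or.inl ⟨a, rfl⟩) x hx)
    have := Submodule.disjoint_def.mp hZX.disjoint _
      (fun b ↦ hA.mul_add_mul_mul (x : A) a b) hmem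
    exact eq_neg_of_add_eq_zero_left (congrArg Subtype.val this)
  let B := leftActRange hA hS
  let V₁ : LieSubmodule K B S :=
    lieSubmoduleOfInvariant hA hS X fun a ↦ hX _ (Or.inl ⟨a, rfl⟩)
  let V₂ : LieSubmodule K B S :=
    lieSubmoduleOfInvariant hA hS (Z.comap S.subtype) fun a w hw ↦ (hZ a w hw).1
  have hcC : ∀ a : A, ∃ c ∈ C, leftAct hS c = leftAct hS a := by
    intro a
    have ha : a ∈ S ⊔ C.toSubmodule := hcompl.sup_eq_top ▸ trivial
    obtain ⟨s, hs, c, hc, rfl⟩ := Submodule.mem_sup.mp ha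
    refine ⟨c, hc, LinearMap.ext fun t ↦ Subtype.ext ?_⟩
    change c * (t : A) = (s + c) * t
    rw [add_mul, hSab s hs t t.2, zero_add]
  let φ : C.toSubmodule →ₗ[K] B := LinearMap.codRestrict B.toSubmodule
    (leftAct hS ∘ₗ C.toSubmodule.subtype) fun c ↦ ⟨c, rfl⟩
  have hφ : Function.Bijective φ := by
    constructor
    · rw [← LinearMap.ker_eq_bot, LinearMap.ker_eq_bot']
      intro c hc
      exact Subtype.ext (eq_zero_of_leftAct_eq_zero hA hΦ hC hcompl c.2 (congrArg Subtype.val hc))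
    · rintro ⟨_, a, rfl⟩
      obtain ⟨c, hc, hca⟩ := hcC a
      exact ⟨⟨c, hc⟩, Subtype.ext hca⟩
  let e := LinearEquiv.ofBijective φ hφ
  have he : ∀ b : B, ∀ s : S, (e.symm b : A) * s = (⁅b, s⁆ : S) := by
    intro b s
    have : φ (e.symm b) = b := e.apply_symm_apply b
    exact congrArg Subtype.val (LinearMap.congr_fun (congrArg Subtype.val this) s)
  have hlieab : IsLieAbelian B := by
    refine ⟨?_⟩
    rintro ⟨_, a, rfl⟩ ⟨_, b, rfl⟩
    refine Subtype.ext ((leftAct_mul hA hS a b).symm.trans (LinearMap.ext fun s ↦ Subtype.ext ?_))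
    exact hSab _ (hsq (mul_mem_square a b)) s s.2
  refine ⟨S, inferInstance, inferInstance, B, V₁, V₂, hlieab, complementedLattice_socle hA hsq, ?_,
    ?_⟩
  · rw [← LieSubmodule.isCompl_toSubmodule]
    exact hZX.symm
  let F : SemidirectStar V₁ V₂ →ₗ[K] A :=
    (LinearMap.coprod (S.subtype ∘ₗ V₁.toSubmodule.subtype)
      (LinearMap.coprod (S.subtype ∘ₗ V₂.toSubmodule.subtype)
        (C.toSubmodule.subtype ∘ₗ e.symm.toLinearMap)) : V₁ × V₂ × B →ₗ[K] A)
  have hF : ∀ (v₁ : V₁) (v₂ : V₂) (b : B), F (v₁, v₂, b) =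
      ((v₁ : S) : A) + (((v₂ : S) : A) + e.symm b) := fun _ _ _ ↦ rfl
  have hFmul : ∀ p q, F (p * q) = F p * F q := by
    rintro ⟨v₁, v₂, b⟩ ⟨w₁, w₂, c⟩
    have hv : ∀ a, ((v₂ : S) : A) * a = 0 := v₂.2
    have hb := he b
    have hbw₁ : ((⁅b, w₁⁆ : V₁) : S) = ⁅b, (w₁ : S)⁆ := rfl
    have hcv₁ : ((⁅c, v₁⁆ : V₁) : S) = ⁅c, (v₁ : S)⁆ := rfl
    have hbw₂ : ((⁅b, w₂⁆ : V₂) : S) = ⁅b, (w₂ : S)⁆ := rfl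
    have hbc : ⁅b, c⁆ = 0 := hlieab.trivial b c
    refine (hF (⁅b, w₁⁆ - ⁅c, v₁⁆) ⁅b, w₂⁆ ⁅b, c⁆).trans ?_
    rw [hF, hF]
    rw [hbc, map_zero, Submodule.coe_zero, add_zero, LieSubmodule.coe_sub, Submodule.coe_sub,
      hbw₁, hcv₁, hbw₂, ← he, ← he, ← he]
    simp only [add_mul, mul_add, hv, hSab _ (v₁ : S).2 _ (w₁ : S).2,
      hSab _ (v₁ : S).2 _ (w₂ : S).2, hXneg (v₁ : S) v₁.2, hC _ (e.symm b).2 _ (e.symm c).2]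
    abel
  refine ⟨{ toFun := fun p ↦ ⟨F p, trivial⟩, map_smul' := fun r p ↦ Subtype.ext (map_smul F r p),
            map_zero' := Subtype.ext (map_zero F),
            map_add' := fun p q ↦ Subtype.ext (map_add F p q),
            map_mul' := fun p q ↦ Subtype.ext (hFmul p q) }, ?_, ?_⟩
  · rintro ⟨v₁, v₂, b⟩ ⟨w₁, w₂, c⟩ h
    have h' : F (v₁, v₂, b) = F (w₁, w₂, c) := congrArg Subtype.val h
    rw [hF, hF, ← add_assoc, ← add_assoc] at h'
    have h1 : ((e.symm b : A)) - e.symm c = 0 := by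
      refine Submodule.disjoint_def.mp hcompl.disjoint _ ?_
        (sub_mem (e.symm b).2 (e.symm c).2)
      have : (e.symm b : A) - e.symm c = (((w₁ : S) : A) + ((w₂ : S) : A)) -
          (((v₁ : S) : A) + ((v₂ : S) : A)) := by
        rw [sub_eq_sub_iff_add_eq_add, add_comm, h', add_comm]
      rw [this]
      exact sub_mem (add_mem (w₁ : S).2 (w₂ : S).2) (add_mem (v₁ : S).2 (v₂ : S).2)
    have hbc : b = c := e.symm.injective (Subtype.ext (sub_eq_zero.mp h1))
    subst hbc
    have h2 : (v₁ : S) + v₂ = w₁ + w₂ := Subtype.ext (add_right_cancel h')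
    have h3 : (v₁ : S) - w₁ = 0 := by
      refine Submodule.disjoint_def.mp hZX.disjoint _ ?_ (sub_mem v₁.2 w₁.2)
      have : (v₁ : S) - w₁ = w₂ - v₂ := by
        rw [sub_eq_sub_iff_add_eq_add, h2, add_comm]
      rw [this]
      exact sub_mem w₂.2 v₂.2
    have h4 := sub_eq_zero.mp h3
    rw [h4] at h2
    have e1 : v₁ = w₁ := Subtype.ext h4
    have e2 : v₂ = w₂ := Subtype.ext (add_left_cancel h2)
    rw [e1, e2]
  · rintro ⟨a, -⟩
    have ha : a ∈ S ⊔ C.toSubmodule := hcompl.sup_eq_top ▸ trivial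
    obtain ⟨s, hs, c, hc, rfl⟩ := Submodule.mem_sup.mp ha
    have hs' : (⟨s, hs⟩ : S) ∈ X ⊔ Z.comap S.subtype := hZX.symm.sup_eq_top ▸ trivial
    obtain ⟨v, hv, w, hw, hvw⟩ := Submodule.mem_sup.mp hs'
    refine ⟨(⟨v, hv⟩, ⟨w, hw⟩, e ⟨c, hc⟩), Subtype.ext ?_⟩
    refine (hF ⟨v, hv⟩ ⟨w, hw⟩ (e ⟨c, hc⟩)).trans ?_
    rw [e.symm_apply_apply, ← add_assoc]
    exact congrArg (· + c) (congrArg Subtype.val hvw)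

/-- If left multiplications act on the image of `g : U → A` as the elements of the completely
reducible Lie algebra `L` act on `U`, and right multiplications act as the multiples by `ε` of
these operators, then the image of `g` is a sum of minimal ideals. -/
theorem range_le_asoc [FiniteDimensional K A] {V : Type*} [AddCommGroup V] [Module K V]
    {L : LieSubalgebra K (Module.End K V)} [ComplementedLattice (LieSubmodule K L V)]
    (U : LieSubmodule K L V) (g : U →ₗ[K] A)
    (hab : ∀ u v, g u * g v = 0) (ε : K)
    (hact : ∀ a : A, ∃ b : L, ∀ u, a * g u = g ⁅b, u⁆ ∧ g u * a = ε • g ⁅b, u⁆)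
    (hact' : ∀ b : L, ∃ a : A, ∀ u, a * g u = g ⁅b, u⁆) : LinearMap.range g ≤ asoc K A := by
  have hideal : ∀ W : LieSubmodule K L V,
      IsIdeal ((W.toSubmodule.comap U.toSubmodule.subtype).map g) := by
    rintro W a _ ⟨u, hu, rfl⟩
    obtain ⟨b, hb⟩ := hact a
    have hbu : g ⁅b, u⁆ ∈ (W.toSubmodule.comap U.toSubmodule.subtype).map g :=
      ⟨_, W.lie_mem (x := b) hu, rfl⟩
    rw [(hb u).1, (hb u).2]
    exact ⟨hbu, Submodule.smul_mem _ ε hbu⟩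
  refine le_asoc_of_forall_exists_isCompl ?_ ?_ fun J hJ hJg ↦ ?_
  · have h := hideal ⊤
    rwa [LieSubmodule.top_toSubmodule, Submodule.comap_top, Submodule.map_top] at h
  · rintro _ ⟨u, rfl⟩ _ ⟨v, rfl⟩
    exact hab u v
  · let W : LieSubmodule K L V :=
      { (J.comap g).map U.toSubmodule.subtype with
        lie_mem := by
          rintro b _ ⟨u, hu, rfl⟩
          obtain ⟨a, ha⟩ := hact' b
          let u : U := u
          refine ⟨(show U from ⁅b, u⁆), ?_, rfl⟩
          change g ⁅b, u⁆ ∈ J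
          rw [← ha u]
          exact (hJ a _ hu).1 }
    obtain ⟨W', hW'⟩ := exists_isCompl W
    rw [← LieSubmodule.isCompl_toSubmodule] at hW'
    refine ⟨_, hideal W', ?_, le_antisymm (sup_le hJg ?_) ?_⟩
    · rw [eq_bot_iff]
      rintro _ ⟨hxJ, u, hu, rfl⟩
      have hu0 : (u : V) = 0 := Submodule.disjoint_def.mp hW'.disjoint u ⟨u, hxJ, rfl⟩ hu
      rw [Submodule.mem_bot, show u = 0 from Subtype.ext hu0, map_zero]
    · rintro _ ⟨u, -, rfl⟩
      exact ⟨u, rfl⟩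
    · rintro _ ⟨u, rfl⟩
      have hu : (u : V) ∈ W.toSubmodule ⊔ W'.toSubmodule := hW'.sup_eq_top ▸ trivial
      obtain ⟨_, ⟨w, hw, rfl⟩, w', hw', hsum⟩ := Submodule.mem_sup.mp hu
      have huw : ((u - w : U) : V) = w' := by
        rw [LieSubmodule.coe_sub, ← hsum]
        exact add_sub_cancel_left _ _
      have hsplit : g u = g w + g (u - w) := by rw [map_sub, add_sub_cancel]
      rw [hsplit]
      refine Submodule.add_mem_sup hw ⟨u - w, ?_, rfl⟩
      change ((u - w : U) : V) ∈ W'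
      rwa [huw]

section

variable {V : Type*} [AddCommGroup V] [Module K V] {L : LieSubalgebra K (Module.End K V)}
  (V₁ V₂ : LieSubmodule K L V)

/-- The inclusion of `V₁` into `V₁ ⊕ V₂ ⊕ B`. -/
def SemidirectStar.inFst : V₁ →ₗ[K] SemidirectStar V₁ V₂ := LinearMap.inl K V₁ (V₂ × L)

/-- The inclusion of `V₂` into `V₁ ⊕ V₂ ⊕ B`. -/
def SemidirectStar.inSnd : V₂ →ₗ[K] SemidirectStar V₁ V₂ :=
  LinearMap.inr K V₁ (V₂ × L) ∘ₗ LinearMap.inl K V₂ L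

/-- The inclusion of `B` into `V₁ ⊕ V₂ ⊕ B`. -/
def SemidirectStar.inLie : L →ₗ[K] SemidirectStar V₁ V₂ :=
  LinearMap.inr K V₁ (V₂ × L) ∘ₗ LinearMap.inr K V₂ L

variable {V₁ V₂}

open SemidirectStar

theorem SemidirectStar.eq_add (p : SemidirectStar V₁ V₂) :
    p = inFst V₁ V₂ p.1 + inSnd V₁ V₂ p.2.1 + inLie V₁ V₂ p.2.2 := by
  obtain ⟨a, b, c⟩ := p
  refine Prod.ext ?_ (Prod.ext ?_ ?_)
  · change a = a + 0 + 0
    rw [add_zero, add_zero]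
  · change b = 0 + b + 0
    rw [add_zero, zero_add]
  · change c = 0 + 0 + c
    rw [add_zero, zero_add]

theorem SemidirectStar.mul_inFst (p : SemidirectStar V₁ V₂) (v : V₁) :
    p * inFst V₁ V₂ v = inFst V₁ V₂ ⁅p.2.2, v⁆ := by
  refine Prod.ext ?_ (Prod.ext (lie_zero p.2.2) (lie_zero p.2.2))
  change ⁅p.2.2, v⁆ - ⁅(0 : L), p.1⁆ = ⁅p.2.2, v⁆
  rw [zero_lie, sub_zero]

theorem SemidirectStar.inFst_mul (p : SemidirectStar V₁ V₂) (v : V₁) :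
    inFst V₁ V₂ v * p = -inFst V₁ V₂ ⁅p.2.2, v⁆ := by
  rw [← map_neg]
  refine Prod.ext ?_ (Prod.ext (zero_lie p.2.1) (zero_lie p.2.2))
  change ⁅(0 : L), p.1⁆ - ⁅p.2.2, v⁆ = -⁅p.2.2, v⁆
  rw [zero_lie, zero_sub]

theorem SemidirectStar.mul_inSnd (p : SemidirectStar V₁ V₂) (v : V₂) :
    p * inSnd V₁ V₂ v = inSnd V₁ V₂ ⁅p.2.2, v⁆ := by
  refine Prod.ext ?_ (Prod.ext rfl (lie_zero p.2.2))
  change ⁅p.2.2, (0 : V₁)⁆ - ⁅(0 : L), p.1⁆ = 0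
  rw [zero_lie, lie_zero, sub_zero]

theorem SemidirectStar.inSnd_mul (p : SemidirectStar V₁ V₂) (v : V₂) :
    inSnd V₁ V₂ v * p = 0 := by
  refine Prod.ext ?_ (Prod.ext (zero_lie p.2.1) (zero_lie p.2.2))
  change ⁅(0 : L), p.1⁆ - ⁅p.2.2, (0 : V₁)⁆ = 0
  rw [zero_lie, lie_zero, sub_zero]

theorem SemidirectStar.inLie_mul_inLie [IsLieAbelian L] (b c : L) :
    inLie V₁ V₂ b * inLie V₁ V₂ c = 0 := by
  refine Prod.ext ?_ (Prod.ext (lie_zero b) (trivial_lie_zero L L b c))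
  change ⁅b, (0 : V₁)⁆ - ⁅c, (0 : V₁)⁆ = 0
  rw [lie_zero, lie_zero, sub_zero]

end

/-- If `A` is the direct sum of an abelian ideal `B` and an ideal of type I with underlying space
`V₁ ⊕ V₂ ⊕ L`, the abelian socle is `B ⊕ V₁ ⊕ V₂`: it meets `L` trivially because, being abelian,
it annihilates `V₁ ⊕ V₂`. -/
theorem exists_abelian_isCompl_of_isTypeOne [FiniteDimensional K A]
    {B E : NonUnitalSubalgebra K A} (hB : IsIdeal B.toSubmodule) (hE : IsIdeal E.toSubmodule)
    (hBE : IsCompl B.toSubmodule E.toSubmodule) (hBab : IsAbelian B.toSubmodule)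
    (hE1 : IsTypeOne K E) :
    ∃ C : NonUnitalSubalgebra K A, IsAbelian C.toSubmodule ∧
      IsCompl (asoc K A) C.toSubmodule := by
  obtain ⟨V, _, _, L, V₁, V₂, hL, hcl, hV, f, hf⟩ := hE1
  let ι : SemidirectStar V₁ V₂ →ₗ[K] A := E.toSubmodule.subtype ∘ₗ (f : _ →ₗ[K] E)
  have hιE : ∀ p, ι p ∈ E := fun p ↦ (f p).2
  have hιmul : ∀ p q, ι p * ι q = ι (p * q) := fun p q ↦
    (congrArg Subtype.val (map_mul f p q)).symm
  have hιinj : Function.Injective ι := Subtype.val_injective.comp hf.1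
  have hcross : ∀ b ∈ B, ∀ x ∈ E, b * x = 0 ∧ x * b = 0 := fun b hb x hx ↦
    ⟨Submodule.disjoint_def.mp hBE.disjoint _ (hB x b hb).2 (hE b x hx).1,
      Submodule.disjoint_def.mp hBE.disjoint _ (hB x b hb).1 (hE b x hx).2⟩
  have hdecomp : ∀ a : A, ∃ b ∈ B, ∃ p, a = b + ι p := by
    intro a
    have ha : a ∈ B.toSubmodule ⊔ E.toSubmodule := hBE.sup_eq_top ▸ trivial
    obtain ⟨b, hb, x, hx, rfl⟩ := Submodule.mem_sup.mp ha
    obtain ⟨p, hp⟩ := hf.2 ⟨x, hx⟩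
    exact ⟨b, hb, p, congrArg (b + ·) (congrArg Subtype.val hp).symm⟩
  have hBcentral : ∀ b ∈ B, ∀ a, a * b = 0 ∧ b * a = 0 := by
    intro b hb a
    obtain ⟨c, hc, p, rfl⟩ := hdecomp a
    rw [add_mul, mul_add, hBab b hb c hc, hBab c hc b hb, (hcross b hb _ (hιE p)).1,
      (hcross b hb _ (hιE p)).2, add_zero]
    exact ⟨rfl, rfl⟩
  have hBS : B.toSubmodule ≤ asoc K A := by
    refine le_asoc_of_forall_exists_isCompl hB hBab fun J _ hJB ↦ ?_
    obtain ⟨J', hJ'⟩ := Submodule.exists_isCompl J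
    refine ⟨J' ⊓ B.toSubmodule, fun a x hx ↦ ?_, ?_, ?_⟩
    · rw [(hBcentral x hx.2 a).1, (hBcentral x hx.2 a).2]
      exact ⟨zero_mem _, zero_mem _⟩
    · rw [← inf_assoc, hJ'.inf_eq_bot, bot_inf_eq]
    · rw [← sup_inf_assoc_of_le _ hJB, hJ'.sup_eq_top, top_inf_eq]
  have hV₁ : LinearMap.range (ι ∘ₗ SemidirectStar.inFst V₁ V₂) ≤ asoc K A := by
    refine range_le_asoc V₁ _ (fun u v ↦ ?_) (-1)
      (fun a ↦ ?_) fun b ↦ ⟨ι (SemidirectStar.inLie V₁ V₂ b), fun u ↦ ?_⟩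
    · change ι _ * ι _ = 0
      rw [hιmul, SemidirectStar.mul_inFst]
      change ι (SemidirectStar.inFst V₁ V₂ ⁅(0 : L), v⁆) = 0
      rw [zero_lie, map_zero, map_zero]
    · obtain ⟨b, hb, p, rfl⟩ := hdecomp a
      refine ⟨p.2.2, fun u ↦ ?_⟩
      change (b + ι p) * ι _ = ι _ ∧ ι _ * (b + ι p) = (-1 : K) • ι _
      rw [add_mul, mul_add, (hBcentral b hb _).2, (hBcentral b hb _).1, hιmul, hιmul,
        SemidirectStar.mul_inFst, SemidirectStar.inFst_mul, zero_add, zero_add, map_neg, neg_smul,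
        one_smul]
      exact ⟨rfl, rfl⟩
    · change ι _ * ι _ = ι _
      rw [hιmul, SemidirectStar.mul_inFst]
      rfl
  have hV₂ : LinearMap.range (ι ∘ₗ SemidirectStar.inSnd V₁ V₂) ≤ asoc K A := by
    refine range_le_asoc V₂ _ (fun u v ↦ ?_) 0 (fun a ↦ ?_)
      fun b ↦ ⟨ι (SemidirectStar.inLie V₁ V₂ b), fun u ↦ ?_⟩
    · change ι _ * ι _ = 0
      rw [hιmul, SemidirectStar.inSnd_mul, map_zero]
    · obtain ⟨b, hb, p, rfl⟩ := hdecomp a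
      refine ⟨p.2.2, fun u ↦ ?_⟩
      change (b + ι p) * ι _ = ι _ ∧ ι _ * (b + ι p) = (0 : K) • ι _
      rw [add_mul, mul_add, (hBcentral b hb _).2, (hBcentral b hb _).1, hιmul, hιmul,
        SemidirectStar.mul_inSnd, SemidirectStar.inSnd_mul, zero_add, zero_add, map_zero, zero_smul]
      exact ⟨rfl, rfl⟩
    · change ι _ * ι _ = ι _
      rw [hιmul, SemidirectStar.mul_inSnd]
      rfl
  have hLab : ∀ b c : L, ι (SemidirectStar.inLie V₁ V₂ b) * ι (SemidirectStar.inLie V₁ V₂ c) = 0 :=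
    fun b c ↦ by rw [hιmul, SemidirectStar.inLie_mul_inLie, map_zero]
  let C : NonUnitalSubalgebra K A :=
    (LinearMap.range (ι ∘ₗ SemidirectStar.inLie V₁ V₂)).toNonUnitalSubalgebra (by
      rintro _ _ ⟨b, rfl⟩ ⟨c, rfl⟩
      exact hLab b c ▸ zero_mem _)
  refine ⟨C, ?_, ?_, ?_⟩
  · rintro _ ⟨b, rfl⟩ _ ⟨c, rfl⟩
    exact hLab b c
  · rw [Submodule.disjoint_def]
    rintro _ hx ⟨b, rfl⟩
    have h1 : ∀ v : V₁, ⁅b, v⁆ = 0 := by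
      intro v
      have h : ι (SemidirectStar.inLie V₁ V₂ b) * ι (SemidirectStar.inFst V₁ V₂ v) = 0 :=
        isAbelian_asoc _ hx _ (hV₁ ⟨v, rfl⟩)
      rw [hιmul, SemidirectStar.mul_inFst] at h
      exact (hιinj.comp LinearMap.inl_injective) (h.trans (map_zero (ι ∘ₗ _)).symm)
    have h2 : ∀ v : V₂, ⁅b, v⁆ = 0 := by
      intro v
      have h : ι (SemidirectStar.inLie V₁ V₂ b) * ι (SemidirectStar.inSnd V₁ V₂ v) = 0 :=
        isAbelian_asoc _ hx _ (hV₂ ⟨v, rfl⟩)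
      rw [hιmul, SemidirectStar.mul_inSnd] at h
      exact (hιinj.comp (LinearMap.inr_injective.comp LinearMap.inl_injective))
        (h.trans (map_zero (ι ∘ₗ SemidirectStar.inSnd V₁ V₂)).symm)
    have hb0 : b = 0 := by
      refine Subtype.ext (LinearMap.ext fun v ↦ ?_)
      rw [← LieSubmodule.isCompl_toSubmodule] at hV
      have hv : v ∈ V₁.toSubmodule ⊔ V₂.toSubmodule := hV.sup_eq_top ▸ trivial
      obtain ⟨v₁, hv₁, v₂, hv₂, rfl⟩ := Submodule.mem_sup.mp hv
      rw [map_add]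
      have e1 : (b : Module.End K V) v₁ = 0 := congrArg Subtype.val (h1 ⟨v₁, hv₁⟩)
      have e2 : (b : Module.End K V) v₂ = 0 := congrArg Subtype.val (h2 ⟨v₂, hv₂⟩)
      rw [e1, e2, add_zero]
      rfl
    rw [hb0, map_zero]
  · rw [codisjoint_iff, eq_top_iff]
    rintro a -
    obtain ⟨b, hb, p, rfl⟩ := hdecomp a
    rw [SemidirectStar.eq_add p, map_add, map_add, ← add_assoc]
    exact Submodule.add_mem_sup (add_mem (hBS hb) (add_mem (hV₁ ⟨_, rfl⟩) (hV₂ ⟨_, rfl⟩)))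
      ⟨_, rfl⟩

end TypeOne

end LeibnizAlg

theorem mainTheorem6 {K : Type*} {A : Type*} [Field K] [PerfectField K]
    [NonUnitalNonAssocRing A] [Module K A] [IsScalarTower K A A] [SMulCommClass K A A]
    [FiniteDimensional K A]
    (hLeibniz : LeibnizAlg.IsLeibniz A) (hSolvable : LeibnizAlg.IsSolvableAlg K A) :
    List.TFAE [
      LeibnizAlg.IsElementary K A,
      LeibnizAlg.frattiniIdeal K A = ⊥ ∧ LeibnizAlg.IsNilpotentSub (LeibnizAlg.square K A),
      LeibnizAlg.frattiniIdeal K A = ⊥ ∧ LeibnizAlg.IsMetabelian K A,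
      ∃ C : NonUnitalSubalgebra K A,
        LeibnizAlg.IsAbelian C.toSubmodule ∧ IsCompl (LeibnizAlg.asoc K A) C.toSubmodule,
      ∃ B E : NonUnitalSubalgebra K A,
        LeibnizAlg.IsIdeal B.toSubmodule ∧ LeibnizAlg.IsIdeal E.toSubmodule ∧
        IsCompl B.toSubmodule E.toSubmodule ∧
        LeibnizAlg.IsAbelian B.toSubmodule ∧ LeibnizAlg.IsTypeOne K E] := by
  have hFrattini : ∀ C : NonUnitalSubalgebra K A, LeibnizAlg.IsAbelian C.toSubmodule →
      IsCompl (LeibnizAlg.asoc K A) C.toSubmodule → ∀ M : NonUnitalSubalgebra K A,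
        LeibnizAlg.FrattiniTrivial M :=
    fun _ hC hcompl ↦ LeibnizAlg.frattiniTrivial_of_isCompl hLeibniz hC hcompl
  tfae_have 1 → 4 := fun h ↦ LeibnizAlg.exists_abelian_isCompl_of_isElementary hLeibniz hSolvable
    (LeibnizAlg.isElementary_iff.mp h)
  tfae_have 4 → 1 := fun ⟨C, hC, hcompl⟩ ↦ LeibnizAlg.isElementary_iff.mpr (hFrattini C hC hcompl)
  tfae_have 4 → 3 := fun ⟨C, hC, hcompl⟩ ↦
    ⟨LeibnizAlg.frattiniIdeal_eq_bot_iff_top.mpr (hFrattini C hC hcompl ⊤),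
      LeibnizAlg.isAbelian_asoc.mono
        (LeibnizAlg.square_le_of_isCompl LeibnizAlg.isIdeal_asoc hC hcompl)⟩
  tfae_have 3 → 2 := fun ⟨hΦ, h⟩ ↦ ⟨hΦ, 1, LeibnizAlg.prod_eq_bot_iff.mpr h⟩
  tfae_have 2 → 4 := fun ⟨hΦ, h⟩ ↦ by
    rw [LeibnizAlg.frattiniIdeal_eq_bot_iff_top] at hΦ
    exact LeibnizAlg.exists_abelian_isCompl_of_isMetabelian hLeibniz hΦ
      (hΦ.isAbelian_of_isNilpotent hLeibniz (LeibnizAlg.isIdeal_top.prod_self hLeibniz) h)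
  -- the abelian direct summand may be taken to be zero, since `V₁` and `V₂` may contain trivial
  -- submodules
  tfae_have 4 → 5 := fun ⟨C, hC, hcompl⟩ ↦ by
    have hbot : ∀ x ∈ (⊥ : NonUnitalSubalgebra K A), x = 0 := fun x hx ↦
      NonUnitalAlgebra.mem_bot.mp hx
    refine ⟨⊥, ⊤, fun a x hx ↦ ?_, fun _ _ _ ↦ ⟨trivial, trivial⟩, ⟨?_, ?_⟩, fun x hx y _ ↦ ?_,
      LeibnizAlg.isTypeOne_of_isCompl hLeibniz hC hcompl⟩
    · rw [hbot x hx, mul_zero, zero_mul]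
      exact ⟨zero_mem _, zero_mem _⟩
    · exact Submodule.disjoint_def.mpr fun x hx _ ↦ hbot x hx
    · exact codisjoint_iff.mpr (sup_eq_right.mpr fun _ _ ↦ trivial)
    · rw [hbot x hx, zero_mul]
  tfae_have 5 → 4 := fun ⟨B, E, hB, hE, hBE, hBab, hE1⟩ ↦
    LeibnizAlg.exists_abelian_isCompl_of_isTypeOne hB hE hBE hBab hE1
  tfae_finish
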